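/- **Notation.** Let $d\ge 1$. For $\mathbf s\in\mathbb N_0^d$ let $\rho(\mathbf s)=\{\mathbf k\in\mathbb Z^d: [2^{s_i-1}]\le |k_i|<2^{s_i},\ i=1,\dots,d\}$, where $[\cdot]$ is the integer part, and for $j\in\mathbb N_0$ let $\Delta Q_j=\bigcup_{\|\mathbf s\|_1=j}\rho(\mathbf s)$. Let $1<p<\infty$, let $(\Omega,\mu)$ be a probability space and let $\Psi=\{\psi_{\mathbf k}\}_{\mathbf k\in\mathbb Z^d}$ be a system in the complex space $L_p(\Omega,\mu)$. For $a>0$, $b\in\mathbb R$, $\beta\in(0,1]$, an *admissible representation* of $f\in L_p(\Omega,\mu)$ is a representation $$f=\sum_{\mathbf k\in\mathbb Z^d}a_{\mathbf k}\psi_{\mathbf k},\qquad \sum_{\mathbf k}|a_{\mathbf k}|<\infty,\qquad \Big(\sum_{\mathbf k\in\Delta Q_j}|a_{\mathbf k}|^\beta\Big)^{1/\beta}\le 2^{-aj}\max(j,1)^{(d-1)b}\quad (j\in\mathbb N_0),$$ the series converging in $L_p(\Omega,\mu)$. The class $\mathbf W^{a,b}_{A_\beta}(\Psi)$ is the set of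 all $f$ that have an admissible representation. For a finite $Q\subset\mathbb Z^d$, a *$v$-term approximant from $\Psi(Q)$* is a linear combination of at most $v$ of the elements $\psi_{\mathbf k}$, $\mathbf k\in Q$. *Weak Chebyshev Greedy Algorithm (WCGA)* with weakness parameter $t\in(0,1]$, for a finite system $\mathcal D$ in a Banach space $X$ and $r\in X$: put $G_0=0$; given $G_i$, take a norming functional $F$ of the residual $r-G_i$ ($\|F\|\le 1$, $F(r-G_i)=\|r-G_i\|$), choose any $\varphi_{i+1}\in\mathcal D$ with $|F(\varphi_{i+1})|\ge t\max_{g\in\mathcal D}|F(g)|$, and let $G_{i+1}$ be a best approximant of $r$ from $\operatorname{span}(\varphi_1,\dots,\varphi_{i+1})$. *Layerwise greedy method*, with parameters $t\in(0,1]$, $J\in\mathbb N_0$ and $\theta_j,w_j\in\mathbb N_0$ ($0\le j<J$), applied to $\sum_{\mathbf k}a_{\mathbf k}\psi_{\mathbf k}$ in $L_p(\Omega,\mu)$: for each $j<J$ keep the terms with the $\min(\theta_j,|\Delta Q_j|)$ largest $|a_{\mathbf k}|$, $\mathbf k\in\Delta Q_j$, and apply $w_j$ iterations of the WCGA with parameter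 $t$ and system $\{\psi_{\mathbf k}\}_{\mathbf k\in\Delta Q_j}$ to the sum of the other terms with $\mathbf k\in\Delta Q_j$; return the sum over $j<J$ of the kept terms and of the WCGA approximants. **Theorem 5.1.** Let $d\ge1$, $1<p<\infty$, $a>0$, $b\in\mathbb R$, $\beta\in(0,1]$, and $p^*:=\min(p,2)$. There are positive constants $c=c(a,\beta,d,p)$ and $C=C(a,b,\beta,d,p)$ such that for every $v\in\mathbb N$, $v\ge1$, there are a finite set $Q\subset\mathbb Z^d$ with $|Q|\le v^c$ and parameters of a layerwise greedy method, both independent of $\Omega$, $\mu$ and $\Psi$, with the following property. Let $\mu$ be a probability measure on a measurable space $\Omega$ and let $\|\psi_{\mathbf k}\|_{L_p(\Omega,\mu)}\le1$ for all $\mathbf k\in\mathbb Z^d$. Then for every $f\in\mathbf W^{a,b}_{A_\beta}(\Psi)$ the method, applied to any admissible representation of $f$, can be carried out, and whatever choices are made in it, its result $A_{v,\mu}(f)$ is a $v$-term approximant from $\Psi(Q)$ and $$\|f-A_{v,\mu}(f)\|_{L_p(\Omega,\mu)}\le C\,v^{-a+1/p^*-1/\beta}\,(\log(2v))^{(d-1)(a+b)}.$$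 -/

import Mathlib

open MeasureTheory
open scoped ENNReal

noncomputable section

namespace MixedGreedy

/-- The dyadic block `ρ(s) = {k ∈ ℤ^d : ⌊2^(s_i - 1)⌋ ≤ |k_i| < 2^(s_i) for all i}`.
The natural-number quotient `2 ^ s i / 2` is `⌊2^(s_i - 1)⌋` (it is `0` when `s_i = 0`). -/
def block {d : ℕ} (s : Fin d → ℕ) : Finset (Fin d → ℤ) :=
  Fintype.piFinset fun i =>
    (Finset.Ioo (-(2 ^ s i : ℤ)) (2 ^ s i)).filter fun k => 2 ^ s i / 2 ≤ k.natAbs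

/-- The hyperbolic layer of level `j`: the union of the blocks `ρ(s)` over `s ∈ ℕ₀^d` with
`s_1 + ⋯ + s_d = j`. -/
def layer (d j : ℕ) : Finset (Fin d → ℤ) :=
  (Finset.piAntidiag (Finset.univ : Finset (Fin d)) j).biUnion block

section NormedSpace

variable {X : Type*} [NormedAddCommGroup X] [NormedSpace ℂ X]

/-- `coef` are the coefficients of an absolutely convergent representation
`f = ∑ coef k • ψ k` whose layers `f_j` satisfy
`|f_j|_{A_β} = (∑_{k in layer j} |coef k|^β)^(1/β) ≤ 2^(-a j) max(j,1)^((d-1) b)`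
for all `j = 0, 1, 2, …`. -/
def IsAdmissibleRep {d : ℕ} (a b β : ℝ) (ψ : (Fin d → ℤ) → X) (f : X)
    (coef : (Fin d → ℤ) → ℂ) : Prop :=
  Summable (fun k => ‖coef k‖) ∧
  HasSum (fun k => coef k • ψ k) f ∧
  ∀ j : ℕ, (∑ k ∈ layer d j, ‖coef k‖ ^ β) ^ (1 / β) ≤
    (2 : ℝ) ^ (-(a * j)) * (max (j : ℝ) 1) ^ (((d : ℝ) - 1) * b)

/-- The class `W^{a,b}_{A_β}(Ψ)`. -/
def mixedClass {d : ℕ} (a b β : ℝ) (ψ : (Fin d → ℤ) → X) : Set X :=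
  {f | ∃ coef, IsAdmissibleRep a b β ψ f coef}

/-- `g` is a `v`-term approximant from `Ψ(Q)`: a linear combination of at most `v` of the
elements `ψ k`, `k ∈ Q`. -/
def IsTermApproximant {ι : Type*} (v : ℕ) (ψ : ι → X) (Q : Finset ι) (g : X) : Prop :=
  ∃ S : Finset ι, S ⊆ Q ∧ S.card ≤ v ∧ ∃ e : ι → ℂ, g = ∑ k ∈ S, e k • ψ k

/-- `g` is a result of `m` iterations of the Weak Chebyshev Greedy Algorithm with weakness
parameter `t`, applied to `r` with respect to the finite system `ψ k`, `k ∈ D`.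
`G i` is the approximant after `i` iterations.  Iteration `i + 1` takes a norming functional `F`
of the residual `r - G i`, picks any `φ i ∈ D` with `|F (ψ (φ i))| ≥ t max_{k ∈ D} |F (ψ k)|`,
and lets `G (i + 1)` be a best approximant of `r` from the linear span of
`ψ (φ 0), …, ψ (φ i)`. -/
def IsWCGAResult {ι : Type*} (t : ℝ) (ψ : ι → X) (D : Finset ι) (r : X) (m : ℕ) (g : X) : Prop :=
  ∃ (φ : ℕ → ι) (G : ℕ → X), G 0 = 0 ∧
    (∀ i < m,
      (φ i ∈ D ∧
        ∃ F : X →L[ℂ] ℂ, ‖F‖ ≤ 1 ∧ F (r - G i) = (‖r - G i‖ : ℂ) ∧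
          ∀ k ∈ D, t * ‖F (ψ k)‖ ≤ ‖F (ψ (φ i))‖) ∧
      G (i + 1) ∈ Submodule.span ℂ {x | ∃ l ≤ i, x = ψ (φ l)} ∧
      ∀ y ∈ Submodule.span ℂ {x | ∃ l ≤ i, x = ψ (φ l)}, ‖r - G (i + 1)‖ ≤ ‖r - y‖) ∧
    G m = g

/-- `I` consists of the `m` indices in `D` with the largest coefficients in absolute value
(of all indices in `D`, if there are fewer than `m`), ties being broken in any way. -/
def IsLargest {ι : Type*} (coef : ι → ℂ) (D : Finset ι) (m : ℕ) (I : Finset ι) : Prop :=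
  I ⊆ D ∧ I.card = min m D.card ∧ ∀ k ∈ I, ∀ l ∈ D, l ∉ I → ‖coef l‖ ≤ ‖coef k‖

/-- The numerical parameters of the layerwise greedy method: the weakness parameter `t`, the
number `J` of layers that are used, and for each layer `j < J` the number `keep j` of largest
coefficients that are kept and the number `steps j` of iterations of the Weak Chebyshev Greedy
Algorithm that are made. -/
structure GreedyMethod where
  t : ℝ
  t_pos : 0 < t
  t_le_one : t ≤ 1
  J : ℕ
  keep : ℕ → ℕ
  steps : ℕ → ℕ

/-- The greedy method `M`, run on the expansion `∑ coef k • ψ k`, can return `g`.  In each layer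
`j < J` it keeps the terms with the `keep j` largest coefficients, and applies `steps j`
iterations of the Weak Chebyshev Greedy Algorithm, with respect to the elements `ψ k` of that
layer, to the sum of the remaining terms of the layer; it returns the sum of everything obtained.
The only freedom in a run is in breaking ties and in the choices that the Weak Chebyshev Greedy
Algorithm leaves open. -/
def GreedyMethod.Returns {d : ℕ} (M : GreedyMethod) (ψ : (Fin d → ℤ) → X)
    (coef : (Fin d → ℤ) → ℂ) (g : X) : Prop :=
  ∃ (I : ℕ → Finset (Fin d → ℤ)) (h : ℕ → X),
    (∀ j < M.J, IsLargest coef (layer d j) (M.keep j) (I j) ∧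
      IsWCGAResult M.t ψ (layer d j) (∑ k ∈ layer d j \ I j, coef k • ψ k) (M.steps j) (h j)) ∧
    g = ∑ j ∈ Finset.range M.J, ((∑ k ∈ I j, coef k • ψ k) + h j)

end NormedSpace

end MixedGreedy

end

namespace MixedGreedy

/-! Two facts about a single layer carry the proof. Keeping the `θ` largest coefficients of a vector
with `β`-quasinorm at most `R` leaves a tail whose `ℓ₁` norm is at most `θ^(1-1/β) R`
(`IsLargest.sum_sdiff_le`). In a space of smoothness power `q`, `θ` iterations of the WCGA reduce an
element with `ℓ₁` coefficient norm `B` to an error of order `B θ^(1/q-1)` (`exists_wcga_rate`).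
Since `L_p` has smoothness power `q = min(p,2)` with a constant independent of the measure space
(`exists_hasPowerSmoothness_Lp`), a layer treated with `2θ` terms contributes an error of order
`θ^(-α) R`, where `α = 1/β - 1/q > 0`.

The rest is a balance of the budget `v` (`exists_parameters`). The layers below a level `n` with
`2^n n^(d-1)` of order `v` are kept whole and cost about half the budget. On layer `n + i` the
number `θ` is of order `v 2^(-κi)`, which is summable in `i`; `κ` is so small that the resulting
loss `2^(ακi)` is beaten by the decay `2^(-ai)` of the class. The errors then form a geometric
series dominated by its first term, `v^(-α) 2^(-an) n^((d-1)b)`, and `2^(-an)` is at most of order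
`v^(-a) n^((d-1)a)` with `n` comparable to `log(2v)`. Once `v 2^(-κi)` drops below a fixed constant
the layers are discarded: this happens after `O(log v)` layers, so only polynomially many indices
are involved. -/

/-! ### Uniform smoothness of `L_p` -/

/-- A quantitative form of uniform smoothness of power type `q`. -/
def HasPowerSmoothness (X : Type*) [NormedAddCommGroup X] [NormedSpace ℂ X] (K q : ℝ) : Prop :=
  ∀ x z : X, ‖x‖ = 1 → ‖z‖ ≤ 1 → ∀ u : ℝ, 0 ≤ u → u ≤ 1 →
    ‖x + (u : ℂ) • z‖ + ‖x - (u : ℂ) • z‖ ≤ 2 + 2 * K * u ^ q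

/-- For `|y| ≤ 1` this is the Taylor remainder; for `|y| > 1` the quadratic term alone absorbs
`e^s`. The exact linear term is what matters: it cancels when `y` and `-y` are added. -/
theorem exp_le_one_add_add_sq {s y : ℝ} (hs : 0 ≤ s) (hy : |y| ≤ s) :
    Real.exp y ≤ 1 + y + Real.exp s * y ^ 2 := by
  have hes : 1 ≤ Real.exp s := Real.one_le_exp hs
  by_cases h : |y| ≤ 1
  · have h1 := Real.norm_exp_sub_one_sub_id_le (x := y) (by simpa using h)
    have h2 := (abs_le.1 h1).2
    rw [Real.norm_eq_abs, sq_abs] at h2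
    nlinarith [sq_nonneg y]
  · push Not at h
    have h3 : Real.exp y ≤ Real.exp s := Real.exp_le_exp.2 ((le_abs_self y).trans hy)
    have h4 : 1 ≤ y ^ 2 := by
      rw [← sq_abs]; nlinarith
    rcases le_total 0 y with hy0 | hy0
    · nlinarith
    · have h5 : Real.exp y ≤ 1 := Real.exp_le_one_iff.2 hy0
      have h6 : -y ≤ y ^ 2 := by
        rw [abs_of_nonpos hy0] at h; nlinarith
      nlinarith

theorem one_add_rpow_le {s x : ℝ} (hs : 0 ≤ s) (hx : |x| ≤ 1) :
    (1 + x) ^ s ≤ 1 + s * x + Real.exp s * s ^ 2 * x ^ 2 := by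
  have hx1 := abs_le.1 hx
  have h0 : 0 ≤ 1 + x := by linarith
  have h1 : (1 + x) ^ s ≤ Real.exp (s * x) := by
    calc (1 + x) ^ s ≤ (Real.exp x) ^ s :=
          Real.rpow_le_rpow h0 (by linarith [Real.add_one_le_exp x]) hs
      _ = Real.exp (s * x) := by rw [← Real.exp_mul, mul_comm]
  have h2 := exp_le_one_add_add_sq (s := s) (y := s * x) hs
    (by rw [abs_mul, abs_of_nonneg hs]; nlinarith)
  nlinarith

theorem add_rpow_le_two_rpow_mul {s x y : ℝ} (hs : 0 ≤ s) (hx : 0 ≤ x) (hy : 0 ≤ y) :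
    (x + y) ^ s ≤ 2 ^ s * (x ^ s + y ^ s) := by
  rcases le_total x y with h | h
  · calc (x + y) ^ s ≤ (2 * y) ^ s := Real.rpow_le_rpow (by positivity) (by linarith) hs
      _ = 2 ^ s * y ^ s := Real.mul_rpow (by norm_num) hy
      _ ≤ _ := by gcongr; linarith [Real.rpow_nonneg hx s]
  · calc (x + y) ^ s ≤ (2 * x) ^ s := Real.rpow_le_rpow (by positivity) (by linarith) hs
      _ = 2 ^ s * x ^ s := Real.mul_rpow (by norm_num) hx
      _ ≤ _ := by gcongr; linarith [Real.rpow_nonneg hy s]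

theorem rpow_add_rpow_sub_le_of_le_one {s A B : ℝ} (hs : 0 ≤ s) (hs1 : s ≤ 1) (hB : |B| ≤ A) :
    (A + B) ^ s + (A - B) ^ s ≤ 2 * A ^ s := by
  have h := abs_le.1 hB
  have := (Real.concaveOn_rpow hs hs1).2 (show A + B ∈ Set.Ici 0 by simp; linarith)
    (show A - B ∈ Set.Ici 0 by simp; linarith)
    (show (0 : ℝ) ≤ 1 / 2 by norm_num) (show (0 : ℝ) ≤ 1 / 2 by norm_num) (by norm_num)
  simp only [smul_eq_mul] at this
  rw [show 1 / 2 * (A + B) + 1 / 2 * (A - B) = A by ring] at this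
  linarith

/-- The second-order bounds at `B/A` and `-B/A` are added, and the linear terms cancel. The extra
factor `A` on both sides keeps the exponent of `A` nonnegative (`s - 1` instead of `s - 2`), so that
`A = 0` is harmless. -/
theorem rpow_add_rpow_sub_le_of_one_le {s A B : ℝ} (hs : 1 ≤ s) (hA : 0 ≤ A) (hB : |B| ≤ A) :
    A * ((A + B) ^ s + (A - B) ^ s) ≤
      2 * A * A ^ s + 2 * (Real.exp s * s ^ 2) * (A ^ (s - 1) * B ^ 2) := by
  rcases hA.eq_or_lt with rfl | hA
  · have : B = 0 := by simpa using hB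
    subst this; simp
  have hx : |B / A| ≤ 1 := by
    rw [abs_div, abs_of_pos hA]; exact (div_le_one hA).2 hB
  have hx' := abs_le.1 hx
  have h1 := one_add_rpow_le (s := s) (x := B / A) (by linarith) hx
  have h2 := one_add_rpow_le (s := s) (x := -(B / A)) (by linarith) (by rwa [abs_neg])
  have e1 : (A + B) ^ s = A ^ s * (1 + B / A) ^ s := by
    rw [← Real.mul_rpow hA.le (by linarith)]; congr 1; field_simp
  have e2 : (A - B) ^ s = A ^ s * (1 + -(B / A)) ^ s := by
    rw [← Real.mul_rpow hA.le (by linarith)]; congr 1; field_simp; ring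
  have e3 : A ^ s = A ^ (s - 1) * A := by
    rw [← Real.rpow_add_one hA.ne']; ring_nf
  have h3 : (A + B) ^ s + (A - B) ^ s ≤ A ^ s * (2 + 2 * (Real.exp s * s ^ 2) * (B / A) ^ 2) := by
    rw [e1, e2, ← mul_add]
    rw [neg_sq] at h2
    exact mul_le_mul_of_nonneg_left (by linarith) (Real.rpow_nonneg hA.le s)
  calc A * ((A + B) ^ s + (A - B) ^ s)
      ≤ A * (A ^ s * (2 + 2 * (Real.exp s * s ^ 2) * (B / A) ^ 2)) := by gcongr
    _ = 2 * A * A ^ s + 2 * (Real.exp s * s ^ 2) * (A ^ (s - 1) * B ^ 2) := by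
      rw [e3]; field_simp

theorem norm_rpow_eq_sq_rpow (w : ℂ) (P : ℝ) : ‖w‖ ^ P = (‖w‖ ^ 2) ^ (P / 2) := by
  rw [← Real.rpow_natCast, ← Real.rpow_mul (norm_nonneg _)]
  congr 1; push_cast; ring

/-- The pointwise form of smoothness. By the parallelogram expansion the squared moduli are `A + B`
and `A - B` with `A = ‖w‖² + u²‖z‖²`, so only the power `P/2` of real numbers is involved: it is
concave and subadditive for `P ≤ 2`, and has a second-order expansion for `P ≥ 2`. -/
theorem exists_norm_add_rpow_le {P : ℝ} (hP : 1 < P) : ∃ K : ℝ, 1 ≤ K ∧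
    ∀ (w z : ℂ) (u : ℝ), 0 ≤ u → u ≤ 1 →
      ‖w + (u : ℂ) * z‖ ^ P + ‖w - (u : ℂ) * z‖ ^ P ≤
        2 * ‖w‖ ^ P + K * u ^ min P 2 * (‖w‖ ^ P + ‖z‖ ^ P) := by
  have key (w z : ℂ) (u : ℝ) (hu : 0 ≤ u) : ∃ B : ℝ, |B| ≤ 2 * u * (‖w‖ * ‖z‖) ∧
      ‖w + (u : ℂ) * z‖ ^ 2 = (‖w‖ ^ 2 + u ^ 2 * ‖z‖ ^ 2) + B ∧
      ‖w - (u : ℂ) * z‖ ^ 2 = (‖w‖ ^ 2 + u ^ 2 * ‖z‖ ^ 2) - B := by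
    refine ⟨2 * u * (inner ℝ w z), ?_, ?_, ?_⟩
    · rw [abs_mul, abs_of_nonneg (by positivity : 0 ≤ 2 * u)]
      gcongr; exact abs_real_inner_le_norm w z
    · have := norm_add_sq_real w (u • z)
      rw [Complex.real_smul] at this
      rw [this, ← Complex.real_smul, inner_smul_right, norm_smul, Real.norm_eq_abs,
        abs_of_nonneg hu]; ring
    · have := norm_sub_sq_real w (u • z)
      rw [Complex.real_smul] at this
      rw [this, ← Complex.real_smul, inner_smul_right, norm_smul, Real.norm_eq_abs,
        abs_of_nonneg hu]; ring
  rcases le_total P 2 with h2 | h2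
  · refine ⟨2, by norm_num, fun w z u hu hu1 => ?_⟩
    obtain ⟨B, hB, e1, e2⟩ := key w z u hu
    have hBA : |B| ≤ ‖w‖ ^ 2 + u ^ 2 * ‖z‖ ^ 2 := by nlinarith [sq_nonneg (‖w‖ - u * ‖z‖)]
    have h3 := rpow_add_rpow_sub_le_of_le_one (s := P / 2) (by linarith) (by linarith) hBA
    have h4 : (‖w‖ ^ 2 + u ^ 2 * ‖z‖ ^ 2) ^ (P / 2) ≤ ‖w‖ ^ P + u ^ P * ‖z‖ ^ P := by
      have := Real.rpow_add_le_add_rpow (p := P / 2) (sq_nonneg ‖w‖) (sq_nonneg (u * ‖z‖))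
        (by linarith) (by linarith)
      rw [mul_pow] at this
      refine this.trans (le_of_eq ?_)
      have e : (u ^ 2) ^ (P / 2) = u ^ P := by
        have := norm_rpow_eq_sq_rpow (u : ℂ) P
        rw [Complex.norm_real, Real.norm_of_nonneg hu] at this
        exact this.symm
      rw [Real.mul_rpow (sq_nonneg _) (sq_nonneg _), ← norm_rpow_eq_sq_rpow,
        ← norm_rpow_eq_sq_rpow, e]
    rw [norm_rpow_eq_sq_rpow (w + _), norm_rpow_eq_sq_rpow (w - _), e1, e2, min_eq_left h2]
    have : 0 ≤ u ^ P * ‖w‖ ^ P := by positivity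
    nlinarith
  · set s := P / 2 with hs
    have hs1 : 1 ≤ s := by rw [hs]; linarith
    -- The `8` term is the second-order remainder, the `2` comes from replacing `A^s` by `‖w‖^P`,
    -- and `2^s` from splitting `T^s`.
    refine ⟨(8 * (Real.exp s * s ^ 2) + 2) * 2 ^ s, ?_, fun w z u hu hu1 => ?_⟩
    · have : (1 : ℝ) ≤ 2 ^ s := Real.one_le_rpow (by norm_num) (by linarith)
      have : 0 ≤ Real.exp s * s ^ 2 := by positivity
      nlinarith
    obtain ⟨B, hB, e1, e2⟩ := key w z u hu
    set A := ‖w‖ ^ 2 + u ^ 2 * ‖z‖ ^ 2 with hA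
    have hBA : |B| ≤ A := by nlinarith [sq_nonneg (‖w‖ - u * ‖z‖)]
    have hA0 : 0 ≤ A := by positivity
    set T := ‖w‖ ^ 2 + ‖z‖ ^ 2 with hT
    have hu2 : u ^ 2 ≤ 1 := by nlinarith
    have hAT : A ≤ T := by rw [hA, hT]; nlinarith [sq_nonneg ‖z‖]
    have hT0 : 0 ≤ T := by positivity
    have hTs : T ^ s ≤ 2 ^ s * (‖w‖ ^ P + ‖z‖ ^ P) := by
      have := add_rpow_le_two_rpow_mul (s := s) (by linarith) (sq_nonneg ‖w‖) (sq_nonneg ‖z‖)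
      rwa [hs, ← norm_rpow_eq_sq_rpow, ← norm_rpow_eq_sq_rpow, ← hs] at this
    -- `A` is the convex combination `(1 - u²)‖w‖² + u² T`.
    have hAs : A ^ s ≤ ‖w‖ ^ P + u ^ 2 * T ^ s := by
      have := (convexOn_rpow hs1).2 (show ‖w‖ ^ 2 ∈ Set.Ici 0 by simp)
        (show T ∈ Set.Ici 0 by simpa using hT0) (show 0 ≤ 1 - u ^ 2 by linarith)
        (show 0 ≤ u ^ 2 by positivity) (by ring)
      simp only [smul_eq_mul] at this
      rw [show (1 - u ^ 2) * ‖w‖ ^ 2 + u ^ 2 * T = A by rw [hT, hA]; ring, hs,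
        ← norm_rpow_eq_sq_rpow, ← hs] at this
      have h0 : 0 ≤ ‖w‖ ^ P := by positivity
      nlinarith [sq_nonneg u]
    have hmain : (A + B) ^ s + (A - B) ^ s ≤
        2 * A ^ s + 8 * (Real.exp s * s ^ 2) * (u ^ 2 * T ^ s) := by
      rcases hA0.eq_or_lt with h0 | h0
      · have hB0 : B = 0 := by rw [← h0] at hBA; simpa using hBA
        rw [hB0, ← h0]
        simp only [add_zero, sub_zero]
        have : 0 ≤ 8 * (Real.exp s * s ^ 2) * (u ^ 2 * T ^ s) := by positivity
        linarith
      have h3 := rpow_add_rpow_sub_le_of_one_le hs1 hA0 hBA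
      have hB2 : B ^ 2 ≤ 4 * u ^ 2 * (A * T) := by
        have h5 : B ^ 2 ≤ (2 * u * (‖w‖ * ‖z‖)) ^ 2 := sq_le_sq' (by linarith [(abs_le.1 hB).1])
          (abs_le.1 hB).2
        have h6 : ‖w‖ ^ 2 * ‖z‖ ^ 2 ≤ A * T := by
          apply mul_le_mul
          · rw [hA]; nlinarith [sq_nonneg (u * ‖z‖)]
          · rw [hT]; nlinarith [sq_nonneg ‖w‖]
          · positivity
          · positivity
        nlinarith [mul_le_mul_of_nonneg_left h6 (by positivity : 0 ≤ 4 * u ^ 2)]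
      have hAT1 : A ^ (s - 1) * T ≤ T ^ s := by
        have hT1 : 0 < T := lt_of_lt_of_le h0 hAT
        calc A ^ (s - 1) * T ≤ T ^ (s - 1) * T := by
              gcongr
          _ = T ^ s := by rw [← Real.rpow_add_one hT1.ne']; ring_nf
      have h7 : A ^ (s - 1) * B ^ 2 ≤ A * (4 * u ^ 2 * T ^ s) := by
        calc A ^ (s - 1) * B ^ 2 ≤ A ^ (s - 1) * (4 * u ^ 2 * (A * T)) := by gcongr
          _ = A * (4 * u ^ 2 * (A ^ (s - 1) * T)) := by ring
          _ ≤ _ := by gcongr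
      have h8 : A * ((A + B) ^ s + (A - B) ^ s) ≤
          A * (2 * A ^ s + 8 * (Real.exp s * s ^ 2) * (u ^ 2 * T ^ s)) := by
        have h9 : 2 * (Real.exp s * s ^ 2) * (A ^ (s - 1) * B ^ 2) ≤
            2 * (Real.exp s * s ^ 2) * (A * (4 * u ^ 2 * T ^ s)) := by gcongr
        linarith
      exact le_of_mul_le_mul_left h8 h0
    rw [norm_rpow_eq_sq_rpow (w + _), norm_rpow_eq_sq_rpow (w - _), e1, e2, min_eq_right h2,
      ← hs, Real.rpow_two]
    have h10 : (8 * (Real.exp s * s ^ 2) + 2) * u ^ 2 * T ^ s ≤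
        (8 * (Real.exp s * s ^ 2) + 2) * u ^ 2 * (2 ^ s * (‖w‖ ^ P + ‖z‖ ^ P)) := by gcongr
    linarith

theorem norm_rpow_eq_integral {Ω : Type*} [MeasurableSpace Ω] {μ : Measure Ω} {p : ℝ≥0∞}
    [Fact (1 ≤ p)] (hp' : p ≠ ∞) (x : Lp ℂ p μ) :
    ‖x‖ ^ p.toReal = ∫ ω, ‖x ω‖ ^ p.toReal ∂μ := by
  have hp0 : p ≠ 0 := (zero_lt_one.trans_le Fact.out).ne'
  have hP : 0 < p.toReal := ENNReal.toReal_pos hp0 hp'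
  have hi : 0 ≤ ∫ ω, ‖x ω‖ ^ p.toReal ∂μ := integral_nonneg fun ω => by positivity
  rw [Lp.norm_def, (Lp.memLp x).eLpNorm_eq_integral_rpow_norm hp0 hp',
    ENNReal.toReal_ofReal (by positivity), ← Real.rpow_mul hi, inv_mul_cancel₀ hP.ne',
    Real.rpow_one]

theorem exists_hasPowerSmoothness_Lp {p : ℝ≥0∞} [Fact (1 ≤ p)] (hp : 1 < p) (hp' : p ≠ ∞) :
    ∃ K : ℝ, 1 ≤ K ∧ ∀ (Ω : Type*) [MeasurableSpace Ω] (μ : Measure Ω),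
      HasPowerSmoothness (Lp ℂ p μ) K (min p.toReal 2) := by
  have hP : 1 < p.toReal := by
    rw [← ENNReal.toReal_one]; exact (ENNReal.toReal_lt_toReal (by simp) hp').2 hp
  obtain ⟨K, hK, hpt⟩ := exists_norm_add_rpow_le hP
  refine ⟨K, hK, fun Ω _ μ x z hx hz u hu hu1 => ?_⟩
  set P := p.toReal with hPdef
  have hP0 : 0 < P := by linarith
  have hp0 : p ≠ 0 := (zero_lt_one.trans hp).ne'
  have hint (y : Lp ℂ p μ) : Integrable (fun ω => ‖y ω‖ ^ P) μ :=
    (Lp.memLp y).integrable_norm_rpow hp0 hp'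
  have hI : ‖x + (u : ℂ) • z‖ ^ P + ‖x - (u : ℂ) • z‖ ^ P ≤
      2 * ‖x‖ ^ P + K * u ^ min P 2 * (‖x‖ ^ P + ‖z‖ ^ P) := by
    simp only [hPdef, norm_rpow_eq_integral hp']
    simp only [← hPdef]
    rw [← integral_add (hint _) (hint _), ← integral_add (hint _) (hint _),
      ← integral_const_mul, ← integral_const_mul, ← integral_add]
    · refine integral_mono_ae ((hint _).add (hint _)) ?_ ?_
      · exact ((hint x).const_mul 2).add (((hint x).add (hint z)).const_mul _)
      filter_upwards [Lp.coeFn_add x ((u : ℂ) • z), Lp.coeFn_sub x ((u : ℂ) • z),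
        Lp.coeFn_smul (u : ℂ) z] with ω h1 h2 h3
      rw [h1, h2]
      simp only [Pi.add_apply, Pi.sub_apply, h3, Pi.smul_apply, smul_eq_mul]
      exact hpt _ _ _ hu hu1
    · exact (hint x).const_mul 2
    · exact ((hint x).add (hint z)).const_mul _
  have hz1 : ‖z‖ ^ P ≤ 1 := Real.rpow_le_one (norm_nonneg _) hz hP0.le
  rw [hx, Real.one_rpow] at hI
  set N₁ := ‖x + (u : ℂ) • z‖
  set N₂ := ‖x - (u : ℂ) • z‖
  have hu0 : 0 ≤ K * u ^ min P 2 := by positivity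
  -- Convexity of the power `P` passes from the mean of the powers to the power of the mean; with `1
  -- + t ≤ (1 + t)^P` the `P`-th root is then taken without changing `K`.
  have hconv := (convexOn_rpow hP.le).2 (show N₁ ∈ Set.Ici 0 by simp [N₁])
    (show N₂ ∈ Set.Ici 0 by simp [N₂])
    (show (0 : ℝ) ≤ 1 / 2 by norm_num) (show (0 : ℝ) ≤ 1 / 2 by norm_num) (by norm_num)
  simp only [smul_eq_mul] at hconv
  have h1 : (1 / 2 * N₁ + 1 / 2 * N₂) ^ P ≤ 1 + K * u ^ min P 2 := by nlinarith
  have h2 : 1 + K * u ^ min P 2 ≤ (1 + K * u ^ min P 2) ^ P :=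
    Real.self_le_rpow_of_one_le (by linarith) hP.le
  have h3 := (Real.rpow_le_rpow_iff (by positivity) (by positivity) hP0).1 (h1.trans h2)
  linarith

/-! ### The Weak Chebyshev Greedy Algorithm in a smooth space -/

section WCGA

variable {X : Type*} [NormedAddCommGroup X] [NormedSpace ℂ X] {K q : ℝ} {ι : Type*}

/-- One step of descent along `z`, in the direction given by a norming functional. -/
theorem HasPowerSmoothness.norm_sub_le (hX : HasPowerSmoothness X K q) {x z : X} (hz : ‖z‖ ≤ 1)
    {F : X →L[ℂ] ℂ} (hF : ‖F‖ ≤ 1) (hFx : F x = (‖x‖ : ℂ)) {u : ℝ} (hu : 0 ≤ u) (hu1 : u ≤ 1) :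
    ‖x - ((u * ‖x‖ : ℝ) : ℂ) • z‖ ≤ ‖x‖ * (1 - u * (F z).re + 2 * K * u ^ q) := by
  rcases eq_or_ne x 0 with rfl | hx
  · simp
  have hx0 : 0 < ‖x‖ := norm_pos_iff.2 hx
  set e : X := ((‖x‖⁻¹ : ℝ) : ℂ) • x with he
  have hxe : x = ((‖x‖ : ℝ) : ℂ) • e := by
    rw [he, smul_smul, ← Complex.ofReal_mul, mul_inv_cancel₀ hx0.ne']; simp
  have hen : ‖e‖ = 1 := by
    rw [he, norm_smul, Complex.norm_real, norm_inv, norm_norm, inv_mul_cancel₀ hx0.ne']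
  have hFe : F e = 1 := by
    rw [he, map_smul, hFx, smul_eq_mul, ← Complex.ofReal_mul, inv_mul_cancel₀ hx0.ne']; simp
  have h1 := hX e z hen hz u hu hu1
  -- Smoothness bounds the sum of the norms at `e + uz` and `e - uz`; testing the first with `F`
  -- from below leaves an upper bound for the second.
  have h2 : 1 + u * (F z).re ≤ ‖e + (u : ℂ) • z‖ := by
    calc 1 + u * (F z).re = (F (e + (u : ℂ) • z)).re := by
          rw [map_add, hFe, map_smul]; simp
      _ ≤ ‖F (e + (u : ℂ) • z)‖ := Complex.re_le_norm _
      _ ≤ ‖F‖ * ‖e + (u : ℂ) • z‖ := F.le_opNorm _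
      _ ≤ 1 * ‖e + (u : ℂ) • z‖ := by gcongr
      _ = _ := one_mul _
  have h3 : x - ((u * ‖x‖ : ℝ) : ℂ) • z = ((‖x‖ : ℝ) : ℂ) • (e - (u : ℂ) • z) := by
    rw [smul_sub, ← hxe, smul_smul, ← Complex.ofReal_mul, mul_comm]
  rw [h3, norm_smul, Complex.norm_real, norm_norm]
  gcongr
  linarith

/-- In a smooth space a norming functional of the error of a best approximant from a subspace
vanishes on that subspace. -/
theorem HasPowerSmoothness.eq_zero_of_best (hX : HasPowerSmoothness X K q) (hq : 1 < q)
    {L : Submodule ℂ X} {x : X} (hbest : ∀ y ∈ L, ‖x‖ ≤ ‖x - y‖)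
    {F : X →L[ℂ] ℂ} (hF : ‖F‖ ≤ 1) (hFx : F x = (‖x‖ : ℂ)) (hx : x ≠ 0) :
    ∀ y ∈ L, F y = 0 := by
  have hx0 : 0 < ‖x‖ := norm_pos_iff.2 hx
  have hre : ∀ y ∈ L, ‖y‖ ≤ 1 → (F y).re ≤ 0 := by
    intro y hy hy1
    -- A descent direction would gain linearly in `u` against a loss of order `u^q`; dividing by `u`
    -- and letting `u → 0` uses `q > 1`.
    have hlim : Filter.Tendsto (fun u : ℝ => 2 * K * u ^ (q - 1)) (nhdsWithin 0 (Set.Ioi 0))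
        (nhds (2 * K * 0 ^ (q - 1))) := by
      have : ContinuousAt (fun u : ℝ => 2 * K * u ^ (q - 1)) 0 :=
        continuousAt_const.mul
          (Real.continuousAt_rpow_const 0 (q - 1) (Or.inr (by linarith)))
      exact this.tendsto.mono_left nhdsWithin_le_nhds
    rw [Real.zero_rpow (by linarith), mul_zero] at hlim
    refine ge_of_tendsto hlim ?_
    filter_upwards [Ioo_mem_nhdsGT (zero_lt_one' ℝ)] with u hu
    have h1 := hX.norm_sub_le hy1 hF hFx hu.1.le hu.2.le
    have h2 := hbest _ (L.smul_mem ((u * ‖x‖ : ℝ) : ℂ) hy)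
    have h3 : 1 ≤ 1 - u * (F y).re + 2 * K * u ^ q :=
      le_of_mul_le_mul_left (by rw [mul_one]; exact h2.trans h1) hx0
    have h4 : u ^ q = u * u ^ (q - 1) := by
      rw [mul_comm, ← Real.rpow_add_one hu.1.ne']; ring_nf
    rw [h4] at h3
    exact le_of_mul_le_mul_left (by linarith : u * (F y).re ≤ u * (2 * K * u ^ (q - 1))) hu.1
  intro y hy
  by_contra hne
  have hy0 : y ≠ 0 := by rintro rfl; simp at hne
  have hFy : 0 < ‖F y‖ := norm_pos_iff.2 hne
  have hyn : 0 < ‖y‖ := norm_pos_iff.2 hy0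
  -- Normalising `y` and rotating its phase makes `F` real and positive on it, contradicting the
  -- sign of the real part.
  set w : ℂ := ((‖y‖⁻¹ : ℝ) : ℂ) * (starRingEnd ℂ (F y) / ((‖F y‖ : ℝ) : ℂ))
  have h1 := hre (w • y) (L.smul_mem _ hy) (by
    rw [norm_smul, norm_mul, norm_div, RCLike.norm_conj, Complex.norm_real, Complex.norm_real,
      norm_norm, norm_inv, norm_norm, div_self hFy.ne', mul_one, inv_mul_cancel₀ hyn.ne'])
  have h2 : F (w • y) = ((‖y‖⁻¹ * ‖F y‖ : ℝ) : ℂ) := by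
    rw [map_smul, smul_eq_mul, mul_assoc, div_mul_eq_mul_div, Complex.conj_mul',
      sq, mul_div_assoc, div_self (by exact_mod_cast hFy.ne')]
    push_cast; ring
  rw [h2, Complex.ofReal_re] at h1
  have : 0 < ‖y‖⁻¹ * ‖F y‖ := by positivity
  linarith

/-- The recursive inequality of greedy approximation. -/
theorem le_rpow_of_greedy_recursion {κ s : ℝ} (hκ : 0 < κ) (hκ1 : κ ≤ 1) (hs : 1 ≤ s) {δ : ℕ → ℝ}
    {m : ℕ} (h0 : ∀ i ≤ m, 0 ≤ δ i) (h1 : δ 0 ≤ 1)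
    (hrec : ∀ i < m, δ (i + 1) ≤ δ i * (1 - κ * δ i ^ s)) :
    δ m ≤ κ ^ (-(1 / s)) * (1 + m : ℝ) ^ (-(1 / s)) := by
  have hs0 : 0 < s := by linarith
  -- The invariant to propagate: `δ i ^ s` decays like `1 / (1 + κ i)`.
  have hy : ∀ i ≤ m, δ i ^ s * (1 + κ * i) ≤ 1 := by
    intro i
    induction i with
    | zero => intro _; simpa using Real.rpow_le_one (h0 0 (Nat.zero_le _)) h1 hs0.le
    | succ i ih =>
      intro hi
      have ih := ih (by omega)
      have hδ := h0 i (by omega)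
      set y := δ i ^ s with hydef
      have hy0 : 0 ≤ y := Real.rpow_nonneg hδ s
      have hr := hrec i (by omega)
      have hi0 : (0 : ℝ) ≤ i := Nat.cast_nonneg i
      have hy1 : y ≤ 1 := by nlinarith [mul_nonneg hκ.le hi0]
      have hc : 0 ≤ 1 - κ * y := by nlinarith
      have h2 : δ (i + 1) ^ s ≤ y * (1 - κ * y) := by
        calc δ (i + 1) ^ s ≤ (δ i * (1 - κ * y)) ^ s :=
              Real.rpow_le_rpow (h0 _ hi) hr hs0.le
          _ = y * (1 - κ * y) ^ s := Real.mul_rpow hδ hc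
          _ ≤ y * (1 - κ * y) := by
            gcongr
            calc (1 - κ * y) ^ s ≤ (1 - κ * y) ^ (1 : ℝ) :=
                  Real.rpow_le_rpow_of_exponent_ge' hc (by nlinarith) zero_le_one hs
              _ = _ := Real.rpow_one _
      have hκi : 0 ≤ κ * i := mul_nonneg hκ.le hi0
      calc δ (i + 1) ^ s * (1 + κ * ((i + 1 : ℕ) : ℝ))
          ≤ y * (1 - κ * y) * (1 + κ * ((i + 1 : ℕ) : ℝ)) := by gcongr
        _ = y * (1 + κ * i) * (1 - κ * y) + κ * y * (1 - κ * y) := by push_cast; ring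
        _ ≤ 1 * (1 - κ * y) + κ * y * 1 := by
          gcongr
          nlinarith
        _ = 1 := by ring
  have hm := hy m le_rfl
  have hm0 : (0 : ℝ) ≤ m := Nat.cast_nonneg m
  have hpos : 0 < κ * (1 + m) := by positivity
  -- Here `κ ≤ 1` gives `κ (1 + m) ≤ 1 + κ m`.
  have h2 : δ m ^ s ≤ (κ * (1 + m))⁻¹ := by
    rw [← one_div, le_div_iff₀ hpos]
    refine le_trans ?_ hm
    have := Real.rpow_nonneg (h0 m le_rfl) s
    gcongr
    linarith
  rw [← Real.mul_rpow hκ.le (by positivity), Real.rpow_neg hpos.le, ← Real.inv_rpow hpos.le]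
  rw [one_div, Real.le_rpow_inv_iff_of_pos (h0 m le_rfl) (by positivity) hs0]
  exact h2

/-- Rate of convergence of the Weak Chebyshev Greedy Algorithm with weakness parameter `1`. -/
theorem HasPowerSmoothness.exists_wcga_rate (hK : 1 ≤ K) (hq : 1 < q) :
    ∃ C : ℝ, 0 < C ∧ ∀ (X : Type*) [NormedAddCommGroup X] [NormedSpace ℂ X] (ι : Type*),
      HasPowerSmoothness X K q → ∀ (ψ : ι → X) (D E : Finset ι), E ⊆ D → (∀ k, ‖ψ k‖ ≤ 1) →
      ∀ (coef : ι → ℂ) (m : ℕ) (g : X),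
        IsWCGAResult 1 ψ D (∑ k ∈ E, coef k • ψ k) m g →
        ‖(∑ k ∈ E, coef k • ψ k) - g‖ ≤
          C * (∑ k ∈ E, ‖coef k‖) * (1 + m : ℝ) ^ (1 / q - 1) := by
  set s := q / (q - 1) with hs
  have hq1 : 0 < q - 1 := by linarith
  have hs1 : 1 ≤ s := by rw [hs, le_div_iff₀ hq1]; linarith
  have hs' : -(1 / s) = 1 / q - 1 := by rw [hs]; field_simp; ring
  -- Chosen so that `κ δ^s` equals the net relative gain `u δ / 2` of one iteration, for the step
  -- size `u` below.
  set κ := (1 / 2 : ℝ) * (4 * K)⁻¹ ^ (1 / (q - 1)) with hκdef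
  have h4K : (4 * K)⁻¹ ≤ 1 := inv_le_one_of_one_le₀ (by linarith)
  have hκ : 0 < κ := by positivity
  have hκ1 : κ ≤ 1 := by
    have := Real.rpow_le_one (by positivity : 0 ≤ (4 * K)⁻¹) h4K
      (by positivity : 0 ≤ 1 / (q - 1))
    linarith
  refine ⟨κ ^ (-(1 / s)), by positivity, ?_⟩
  intro X _ _ ι hX ψ D E hED hψ coef m g hg
  obtain ⟨φ, G, hG0, hstep, rfl⟩ := hg
  set r := ∑ k ∈ E, coef k • ψ k with hr
  set B := ∑ k ∈ E, ‖coef k‖ with hB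
  have hB0 : 0 ≤ B := Finset.sum_nonneg fun _ _ => norm_nonneg _
  have hrB : ‖r‖ ≤ B := norm_sum_le_of_le _ fun k _ => by
    rw [norm_smul]; exact mul_le_of_le_one_right (norm_nonneg _) (hψ k)
  -- The strict inequality makes `L 0` trivial, so that `G 0 = 0` is a best approximant from `L 0`
  -- and all indices are treated alike.
  let L : ℕ → Submodule ℂ X := fun i => Submodule.span ℂ {x | ∃ l < i, x = ψ (φ l)}
  have hL (i : ℕ) : Submodule.span ℂ {x | ∃ l ≤ i, x = ψ (φ l)} = L (i + 1) := by
    simp only [L, Nat.lt_succ_iff]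
  have hLmono (i : ℕ) : L i ≤ L (i + 1) :=
    Submodule.span_mono fun x ⟨l, hl, hx⟩ => ⟨l, by omega, hx⟩
  have hGL : ∀ i ≤ m, G i ∈ L i := by
    rintro (_ | i) hi
    · rw [hG0]; exact zero_mem _
    · rw [← hL]; exact (hstep i hi).2.1
  have hGbest : ∀ i ≤ m, ∀ y ∈ L i, ‖r - G i‖ ≤ ‖r - y‖ := by
    rintro (_ | i) hi y hy
    · have : y = 0 := by simpa [L] using hy
      rw [this, hG0]
    · rw [← hL] at hy; exact (hstep i hi).2.2 y hy
  have hmono : ∀ i < m, ‖r - G (i + 1)‖ ≤ ‖r - G i‖ := fun i hi =>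
    hGbest _ hi _ (hLmono i (hGL i hi.le))
  have hle : ∀ i ≤ m, ‖r - G i‖ ≤ B := by
    intro i hi
    refine (hGbest i hi 0 (zero_mem _)).trans ?_
    simpa using hrB
  rcases hB0.eq_or_lt with hB' | hBpos
  · rw [← hB']
    simpa [← hB'] using hle m le_rfl
  have hrec : ∀ i < m, ‖r - G (i + 1)‖ / B ≤
      ‖r - G i‖ / B * (1 - κ * (‖r - G i‖ / B) ^ s) := by
    intro i hi
    rcases eq_or_ne (r - G i) 0 with h0 | h0
    · have := hmono i hi
      rw [h0, norm_zero] at this ⊢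
      rw [le_antisymm this (norm_nonneg _)]; simp
    obtain ⟨⟨hφD, F, hF, hFr, hmax⟩, -, -⟩ := hstep i hi
    have hpos : 0 < ‖r - G i‖ := norm_pos_iff.2 h0
    have hvan := hX.eq_zero_of_best hq (L := L i) (x := r - G i) (fun y hy => by
      rw [sub_sub]; exact hGbest i hi.le _ ((L i).add_mem (hGL i hi.le) hy)) hF hFr h0
    have hFG : F r = (‖r - G i‖ : ℂ) := by
      rw [← hFr, map_sub, hvan _ (hGL i hi.le), sub_zero]
    -- Since `F` vanishes on `L i`, the residual norm equals `F r`; as `r` is a combination of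
    -- system elements with coefficient sum `B`, the greedy choice must see a value of at least `‖r
    -- - G i‖ / B`.
    have hlow : ‖r - G i‖ ≤ B * ‖F (ψ (φ i))‖ := by
      calc ‖r - G i‖ = ‖F r‖ := by rw [hFG, Complex.norm_real, norm_norm]
        _ ≤ ∑ k ∈ E, ‖coef k‖ * ‖F (ψ (φ i))‖ := by
          rw [hr, map_sum]
          refine norm_sum_le_of_le _ fun k hk => ?_
          rw [map_smul, smul_eq_mul, norm_mul]
          gcongr
          simpa using hmax k (hED hk)
        _ = _ := by rw [hB, Finset.sum_mul]
    set δ := ‖r - G i‖ / B with hδ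
    have hδ0 : 0 < δ := by positivity
    have hδ1 : δ ≤ 1 := (div_le_one hBpos).2 (hle i hi.le)
    have hδF : δ ≤ ‖F (ψ (φ i))‖ := by rw [hδ, div_le_iff₀ hBpos]; linarith
    have hFpos : 0 < ‖F (ψ (φ i))‖ := hδ0.trans_le hδF
    set w : ℂ := starRingEnd ℂ (F (ψ (φ i))) / ((‖F (ψ (φ i))‖ : ℝ) : ℂ) with hw
    have hwn : ‖w‖ = 1 := by
      rw [hw, norm_div, RCLike.norm_conj, Complex.norm_real, norm_norm, div_self hFpos.ne']
    have hFw : F (w • ψ (φ i)) = ((‖F (ψ (φ i))‖ : ℝ) : ℂ) := by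
      rw [map_smul, smul_eq_mul, hw, div_mul_eq_mul_div, Complex.conj_mul',
        sq, mul_div_assoc, div_self (by exact_mod_cast hFpos.ne'), mul_one]
    -- With this step the smoothness loss `2 K u^q` is exactly half of the guaranteed gain `u δ`.
    set u := (δ * (4 * K)⁻¹) ^ (1 / (q - 1)) with hu
    have hu0 : 0 < u := by positivity
    have hu1 : u ≤ 1 := Real.rpow_le_one (by positivity)
      (mul_le_one₀ hδ1 (by positivity) h4K) (by positivity)
    have hdes := hX.norm_sub_le (x := r - G i) (z := w • ψ (φ i))
      (by rw [norm_smul, hwn, one_mul]; exact hψ _) hF hFr hu0.le hu1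
    rw [hFw, Complex.ofReal_re] at hdes
    have hmem : G i + ((u * ‖r - G i‖ : ℝ) : ℂ) • w • ψ (φ i) ∈ L (i + 1) := by
      refine add_mem (hLmono i (hGL i hi.le)) ?_
      exact Submodule.smul_mem _ _ (Submodule.smul_mem _ _
        (Submodule.subset_span ⟨i, Nat.lt_succ_self i, rfl⟩))
    have hnext := hGbest (i + 1) hi _ hmem
    rw [← sub_sub] at hnext
    have huq : 2 * K * u ^ q = u * (δ / 2) := by
      have h1 : u ^ q = u * u ^ (q - 1) := by
        rw [mul_comm, ← Real.rpow_add_one hu0.ne']; ring_nf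
      have h2 : u ^ (q - 1) = δ * (4 * K)⁻¹ := by
        rw [hu, ← Real.rpow_mul (by positivity), one_div_mul_cancel hq1.ne', Real.rpow_one]
      rw [h1, h2]; field_simp; ring
    have huκ : u * (δ / 2) = κ * δ ^ s := by
      have h1 : δ ^ s = δ ^ (1 / (q - 1)) * δ := by
        rw [← Real.rpow_add_one hδ0.ne']; congr 1; rw [hs]; field_simp; ring
      rw [hu, Real.mul_rpow hδ0.le (by positivity), h1, hκdef]; ring
    rw [hδ, div_mul_eq_mul_div, ← hδ]
    gcongr
    refine hnext.trans (hdes.trans ?_)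
    gcongr
    have : u * δ ≤ u * ‖F (ψ (φ i))‖ := by gcongr
    linarith
  have hfin := le_rpow_of_greedy_recursion hκ hκ1 hs1 (δ := fun i => ‖r - G i‖ / B) (m := m)
    (fun i _ => by positivity) (by
      rw [div_le_one hBpos]; exact hle 0 (Nat.zero_le _)) hrec
  rw [div_le_iff₀ hBpos] at hfin
  rw [← hs']
  linarith

/-- A best approximant from a finite-dimensional subspace. -/
theorem exists_best_approximant (L : Submodule ℂ X) [FiniteDimensional ℂ L] (r : X) :
    ∃ g ∈ L, ∀ y ∈ L, ‖r - g‖ ≤ ‖r - y‖ := by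
  have : ProperSpace L := FiniteDimensional.proper ℂ L
  have hlim : Filter.Tendsto (fun y : L => ‖r - y‖) (Filter.cocompact L) Filter.atTop := by
    refine Filter.tendsto_atTop_mono (f := fun y : L => ‖y‖ - ‖r‖) (fun y => ?_)
      (Filter.tendsto_atTop_add_const_right _ _ (tendsto_norm_cocompact_atTop))
    rw [norm_sub_rev r]
    exact norm_sub_norm_le (y : X) r
  obtain ⟨g, hg⟩ := Continuous.exists_forall_le
    (f := fun y : L => ‖r - y‖) (by fun_prop) hlim
  exact ⟨g, g.2, fun y hy => hg ⟨y, hy⟩⟩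

/-- An iteration is never blocked: Hahn–Banach supplies the norming functional, a finite nonempty
system attains the maximum (admissible for every `t ≤ 1`), and finite-dimensional spans have best
approximants. -/
theorem exists_isWCGAResult {t : ℝ} (ht : t ≤ 1) (ψ : ι → X) {D : Finset ι} (hD : D.Nonempty)
    (r : X) (m : ℕ) : ∃ g, IsWCGAResult t ψ D r m g := by
  classical
  obtain ⟨k₀, hk₀⟩ := hD
  induction m with
  | zero => exact ⟨0, fun _ => k₀, fun _ => 0, rfl, by simp, rfl⟩
  | succ m ih =>
    obtain ⟨-, φ, G, hG0, hstep, rfl⟩ := ih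
    obtain ⟨F, hF, hFr⟩ := exists_dual_vector'' ℂ (r - G m)
    obtain ⟨k, hk, hmax⟩ := D.exists_max_image (fun k => ‖F (ψ k)‖) ⟨k₀, hk₀⟩
    -- Changing the selection only at index `m` leaves the spans of all earlier iterations
    -- untouched.
    set φ' := Function.update φ m k with hφ'
    have hset (i : ℕ) : {x | ∃ l ≤ i, x = ψ (φ' l)}.Finite := by
      refine ((Finset.range (i + 1)).finite_toSet.image fun l => ψ (φ' l)).subset ?_
      rintro x ⟨l, hl, rfl⟩
      exact ⟨l, by simpa [Nat.lt_succ_iff] using hl, rfl⟩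
    have : FiniteDimensional ℂ (Submodule.span ℂ {x | ∃ l ≤ m, x = ψ (φ' l)}) :=
      FiniteDimensional.span_of_finite ℂ (hset m)
    obtain ⟨g, hg, hbest⟩ :=
      exists_best_approximant (Submodule.span ℂ {x | ∃ l ≤ m, x = ψ (φ' l)}) r
    refine ⟨g, φ', Function.update G (m + 1) g, by simp [hG0], fun i hi => ?_, by simp⟩
    rcases Nat.lt_succ_iff_lt_or_eq.1 hi with hi | rfl
    · have e : {x | ∃ l ≤ i, x = ψ (φ' l)} = {x | ∃ l ≤ i, x = ψ (φ l)} := by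
        ext x
        refine exists_congr fun l => and_congr_right fun hl => ?_
        rw [hφ', Function.update_of_ne (by omega)]
      rw [e, hφ', Function.update_of_ne (by omega), Function.update_of_ne (by omega),
        Function.update_of_ne (by omega)]
      exact hstep i hi
    · rw [Function.update_self, Function.update_of_ne (by omega)]
      refine ⟨⟨by rw [hφ', Function.update_self]; exact hk, F, hF, hFr, fun l hl => ?_⟩,
        hg, hbest⟩
      rw [hφ', Function.update_self]
      exact (mul_le_of_le_one_left (norm_nonneg _) ht).trans (hmax l hl)

theorem IsTermApproximant.add {v₁ v₂ : ℕ} {ψ : ι → X} {Q : Finset ι} {g₁ g₂ : X}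
    (h₁ : IsTermApproximant v₁ ψ Q g₁) (h₂ : IsTermApproximant v₂ ψ Q g₂) :
    IsTermApproximant (v₁ + v₂) ψ Q (g₁ + g₂) := by
  classical
  obtain ⟨S₁, hS₁, hc₁, e₁, rfl⟩ := h₁
  obtain ⟨S₂, hS₂, hc₂, e₂, rfl⟩ := h₂
  refine ⟨S₁ ∪ S₂, Finset.union_subset hS₁ hS₂,
    (Finset.card_union_le _ _).trans (add_le_add hc₁ hc₂),
    fun k => (if k ∈ S₁ then e₁ k else 0) + if k ∈ S₂ then e₂ k else 0, ?_⟩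
  simp only [add_smul, Finset.sum_add_distrib, ite_smul, zero_smul, Finset.sum_ite_mem,
    Finset.union_inter_cancel_left, Finset.union_inter_cancel_right]

theorem IsTermApproximant.mono {v₁ v₂ : ℕ} {ψ : ι → X} {Q₁ Q₂ : Finset ι} {g : X}
    (h : IsTermApproximant v₁ ψ Q₁ g) (hv : v₁ ≤ v₂) (hQ : Q₁ ⊆ Q₂) :
    IsTermApproximant v₂ ψ Q₂ g := by
  obtain ⟨S, hS, hc, e, he⟩ := h
  exact ⟨S, hS.trans hQ, hc.trans hv, e, he⟩

theorem isTermApproximant_sum {ι' : Type*} (s : Finset ι') {v : ι' → ℕ} {ψ : ι → X} {Q : Finset ι}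
    {g : ι' → X} (h : ∀ i ∈ s, IsTermApproximant (v i) ψ Q (g i)) :
    IsTermApproximant (∑ i ∈ s, v i) ψ Q (∑ i ∈ s, g i) := by
  classical
  induction s using Finset.induction_on with
  | empty => exact ⟨∅, by simp, by simp, 0, by simp⟩
  | insert i s hi ih =>
    rw [Finset.sum_insert hi, Finset.sum_insert hi]
    exact (h i (by simp)).add (ih fun j hj => h j (by simp [hj]))

theorem IsWCGAResult.isTermApproximant {t : ℝ} {ψ : ι → X} {D : Finset ι} {r : X} {m : ℕ} {g : X}
    (h : IsWCGAResult t ψ D r m g) : IsTermApproximant m ψ D g := by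
  classical
  obtain ⟨φ, G, hG0, hstep, rfl⟩ := h
  rcases m with _ | m
  -- Without iterations no span condition is available; the result is `G 0 = 0`.
  · exact ⟨∅, by simp, by simp, 0, by simp [hG0]⟩
  have hmem := (hstep m (Nat.lt_succ_self m)).2.1
  set S := (Finset.range (m + 1)).image φ with hS
  have e : {x | ∃ l ≤ m, x = ψ (φ l)} = ψ '' (S : Set ι) := by
    ext x
    constructor
    · rintro ⟨l, hl, rfl⟩
      exact ⟨φ l, Finset.mem_image_of_mem _ (Finset.mem_range.2 (Nat.lt_succ_of_le hl)), rfl⟩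
    · rintro ⟨k, hk, rfl⟩
      obtain ⟨l, hl, rfl⟩ := Finset.mem_image.1 hk
      exact ⟨l, Nat.lt_succ_iff.1 (Finset.mem_range.1 hl), rfl⟩
  rw [e] at hmem
  obtain ⟨c, hc⟩ := (Submodule.mem_span_image_finset_iff_exists_fun' ℂ).1 hmem
  refine ⟨S, ?_, (Finset.card_image_le).trans (by simp), c, hc.symm⟩
  intro k hk
  obtain ⟨l, hl, rfl⟩ := Finset.mem_image.1 hk
  exact (hstep l (Finset.mem_range.1 hl)).1.1

end WCGA

/-! ### Thresholding of coefficients -/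

section Thresholding

variable {ι : Type*}

theorem exists_isLargest (coef : ι → ℂ) (D : Finset ι) (m : ℕ) : ∃ I, IsLargest coef D m I := by
  classical
  induction m with
  | zero => exact ⟨∅, by simp, by simp, by simp⟩
  | succ m ih =>
    obtain ⟨I, hI, hc, hmax⟩ := ih
    rcases le_or_gt D.card m with h | h
    · exact ⟨I, hI, by omega, hmax⟩
    have hne : (D \ I).Nonempty := by
      rw [← Finset.card_pos, Finset.card_sdiff_of_subset hI]; omega
    obtain ⟨k, hk, hkmax⟩ := (D \ I).exists_max_image (fun k => ‖coef k‖) hne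
    rw [Finset.mem_sdiff] at hk
    refine ⟨insert k I, Finset.insert_subset hk.1 hI, ?_, ?_⟩
    · rw [Finset.card_insert_of_notMem hk.2]; omega
    · intro x hx l hl hlI
      rw [Finset.mem_insert, not_or] at hlI
      rcases Finset.mem_insert.1 hx with rfl | hx
      · exact hkmax l (Finset.mem_sdiff.2 ⟨hl, hlI.2⟩)
      · exact hmax x hx l hl hlI.2

/-- Interpolation between `ℓ_∞` and `ℓ_β`: write `‖c‖ = ‖c‖^(1-β) ‖c‖^β` and bound the first factor
by its supremum. -/
theorem sum_norm_le_of_norm_le {β τ S : ℝ} (hβ : β ≤ 1) {coef : ι → ℂ} {E : Finset ι}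
    (hτ : ∀ k ∈ E, ‖coef k‖ ≤ τ) (hτ0 : 0 ≤ τ) (hS : ∑ k ∈ E, ‖coef k‖ ^ β ≤ S) :
    ∑ k ∈ E, ‖coef k‖ ≤ τ ^ (1 - β) * S := by
  calc ∑ k ∈ E, ‖coef k‖ ≤ ∑ k ∈ E, τ ^ (1 - β) * ‖coef k‖ ^ β := by
        refine Finset.sum_le_sum fun k hk => ?_
        rcases (norm_nonneg (coef k)).eq_or_lt with h | h
        · rw [← h]; positivity
        calc ‖coef k‖ = ‖coef k‖ ^ (1 - β) * ‖coef k‖ ^ β := by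
              rw [← Real.rpow_add h, sub_add_cancel, Real.rpow_one]
          _ ≤ _ := by
            gcongr
            exact hτ k hk
    _ = τ ^ (1 - β) * ∑ k ∈ E, ‖coef k‖ ^ β := by rw [Finset.mul_sum]
    _ ≤ _ := by gcongr

variable {β R : ℝ} {coef : ι → ℂ} {D : Finset ι}

theorem sum_rpow_le_of_quasinorm_le (hβ : 0 < β)
    (h : (∑ k ∈ D, ‖coef k‖ ^ β) ^ (1 / β) ≤ R) : ∑ k ∈ D, ‖coef k‖ ^ β ≤ R ^ β := by
  have h0 : 0 ≤ ∑ k ∈ D, ‖coef k‖ ^ β := Finset.sum_nonneg fun _ _ => by positivity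
  have := Real.rpow_le_rpow (by positivity) h hβ.le
  rwa [← Real.rpow_mul h0, one_div_mul_cancel hβ.ne', Real.rpow_one] at this

theorem nonneg_of_quasinorm_le (h : (∑ k ∈ D, ‖coef k‖ ^ β) ^ (1 / β) ≤ R) : 0 ≤ R := by
  have h0 : 0 ≤ ∑ k ∈ D, ‖coef k‖ ^ β := Finset.sum_nonneg fun _ _ => by positivity
  exact le_trans (by positivity) h

/-- The case `τ = R`, since no coefficient exceeds the quasinorm. -/
theorem sum_norm_le_of_quasinorm_le (hβ : 0 < β) (hβ' : β ≤ 1)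
    (h : (∑ k ∈ D, ‖coef k‖ ^ β) ^ (1 / β) ≤ R) : ∑ k ∈ D, ‖coef k‖ ≤ R := by
  have hR := nonneg_of_quasinorm_le h
  have hS := sum_rpow_le_of_quasinorm_le hβ h
  have := sum_norm_le_of_norm_le hβ' (τ := R) (fun k hk => ?_) hR hS
  · rcases hR.eq_or_lt with h0 | h0
    · rw [← h0, Real.zero_rpow hβ.ne', mul_zero] at this
      rwa [← h0]
    · rwa [← Real.rpow_add h0, sub_add_cancel, Real.rpow_one] at this
  · refine (Real.rpow_le_rpow_iff (norm_nonneg _) hR hβ).1 (le_trans ?_ hS)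
    exact Finset.single_le_sum (f := fun k => ‖coef k‖ ^ β) (fun _ _ => by positivity) hk

/-- Every discarded coefficient is dominated by `θ` kept ones, hence is at most `R θ^(-1/β)`;
interpolating this supremum with the `ℓ_β` bound gives the exponent `1 - 1/β`. -/
theorem IsLargest.sum_sdiff_le [DecidableEq ι] (hβ : 0 < β) (hβ' : β ≤ 1)
    (h : (∑ k ∈ D, ‖coef k‖ ^ β) ^ (1 / β) ≤ R) {θ : ℕ} (hθ : 1 ≤ θ) {I : Finset ι}
    (hI : IsLargest coef D θ I) :
    ∑ k ∈ D \ I, ‖coef k‖ ≤ (θ : ℝ) ^ (1 - 1 / β) * R := by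
  obtain ⟨hID, hcard, hmax⟩ := hI
  have hR := nonneg_of_quasinorm_le h
  have hS := sum_rpow_le_of_quasinorm_le hβ h
  have hθ0 : (0 : ℝ) < θ := by exact_mod_cast hθ
  have hτ : ∀ l ∈ D \ I, ‖coef l‖ ≤ R * (θ : ℝ) ^ (-(1 / β)) := by
    intro l hl
    rw [Finset.mem_sdiff] at hl
    -- If `I` had fewer than `θ` elements it would be all of `D`, and nothing would be discarded.
    have hθI : I.card = θ := by
      by_contra hne
      have : D.card ≤ I.card := by omega
      exact hl.2 (Finset.eq_of_subset_of_card_le hID this ▸ hl.1)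
    have h1 : (θ : ℝ) * ‖coef l‖ ^ β ≤ R ^ β := by
      calc (θ : ℝ) * ‖coef l‖ ^ β = ∑ k ∈ I, ‖coef l‖ ^ β := by simp [hθI]
        _ ≤ ∑ k ∈ I, ‖coef k‖ ^ β := Finset.sum_le_sum fun k hk =>
          Real.rpow_le_rpow (norm_nonneg _) (hmax k hk l hl.1 hl.2) hβ.le
        _ ≤ ∑ k ∈ D, ‖coef k‖ ^ β :=
          Finset.sum_le_sum_of_subset_of_nonneg hID fun _ _ _ => by positivity
        _ ≤ R ^ β := hS
    refine (Real.rpow_le_rpow_iff (norm_nonneg _) (by positivity) hβ).1 ?_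
    rw [Real.mul_rpow hR (by positivity), ← Real.rpow_mul hθ0.le, neg_mul,
      one_div_mul_cancel hβ.ne', Real.rpow_neg_one, ← div_eq_mul_inv, le_div_iff₀ hθ0]
    linarith
  have h2 : ∑ k ∈ D \ I, ‖coef k‖ ^ β ≤ R ^ β := le_trans
    (Finset.sum_le_sum_of_subset_of_nonneg Finset.sdiff_subset fun _ _ _ => by positivity) hS
  refine (sum_norm_le_of_norm_le hβ' hτ (by positivity) h2).trans (le_of_eq ?_)
  rw [Real.mul_rpow hR (by positivity), ← Real.rpow_mul hθ0.le]
  rw [show -(1 / β) * (1 - β) = 1 - 1 / β by field_simp; ring]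
  rcases hR.eq_or_lt with h0 | h0
  · rw [← h0, Real.zero_rpow hβ.ne']; simp
  · rw [mul_right_comm, ← Real.rpow_add h0, sub_add_cancel, Real.rpow_one, mul_comm]

end Thresholding

/-! ### Hyperbolic layers: partition and cardinality -/

/-- The index of the hyperbolic layer that contains `k`. -/
def layerIndex {d : ℕ} (k : Fin d → ℤ) : ℕ := ∑ i, Nat.size (k i).natAbs

/-- The dyadic condition in coordinate `i` says that `|k_i|` has exactly `s_i` binary digits. Hence
the blocks partition `ℤ^d`, and the layers are the fibres of `layerIndex`. -/
theorem mem_block {d : ℕ} {s : Fin d → ℕ} {k : Fin d → ℤ} :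
    k ∈ block s ↔ ∀ i, Nat.size (k i).natAbs = s i := by
  simp only [block, Fintype.mem_piFinset, Finset.mem_filter, Finset.mem_Ioo]
  refine forall_congr' fun i => ?_
  have h1 : (-(2 ^ s i : ℤ) < k i ∧ k i < 2 ^ s i) ↔ Nat.size (k i).natAbs ≤ s i := by
    rw [Nat.size_le, ← abs_lt, Int.abs_eq_natAbs]
    exact_mod_cast Iff.rfl
  have h2 : 2 ^ s i / 2 ≤ (k i).natAbs ↔ s i ≤ Nat.size (k i).natAbs := by
    rcases h : s i with _ | m
    · simp
    · rw [pow_succ, Nat.mul_div_cancel _ two_pos, Nat.succ_le_iff, Nat.lt_size]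
  rw [h1, h2]
  exact ⟨fun h => le_antisymm h.1 h.2, fun h => ⟨h.le, h.ge⟩⟩

theorem mem_layer {d j : ℕ} {k : Fin d → ℤ} : k ∈ layer d j ↔ layerIndex k = j := by
  simp only [layer, Finset.mem_biUnion, Finset.mem_piAntidiag, mem_block]
  constructor
  · rintro ⟨s, ⟨hs, -⟩, h⟩
    simp only [layerIndex, h, hs]
  · intro h
    exact ⟨fun i => Nat.size (k i).natAbs, ⟨h, by simp⟩, fun i => rfl⟩

/-- Needed for the WCGA to have an element to select. The witness is `(2^j - 1, 0, …, 0)`. -/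
theorem layer_nonempty {d : ℕ} (hd : 1 ≤ d) (j : ℕ) : (layer d j).Nonempty := by
  refine ⟨fun i => if i = ⟨0, hd⟩ then 2 ^ j - 1 else 0, mem_layer.2 ?_⟩
  rw [layerIndex, Finset.sum_eq_single ⟨0, hd⟩]
  · have h1 : 1 ≤ 2 ^ j := Nat.one_le_two_pow
    have h2 : ((2 : ℤ) ^ j - 1).natAbs = 2 ^ j - 1 := by
      zify [h1]
      have h3 : (1 : ℤ) ≤ 2 ^ j := by exact_mod_cast h1
      exact abs_of_nonneg (by linarith)
    simp only [if_true, h2]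
    refine le_antisymm (Nat.size_le.2 (by omega)) ?_
    rcases j with _ | j
    · simp
    · refine Nat.lt_size.2 ?_
      have := Nat.one_le_two_pow (n := j)
      rw [pow_succ]; omega
  · intro i _ hi; simp [hi]
  · simp

theorem card_block_le {d : ℕ} (s : Fin d → ℕ) : (block s).card ≤ 2 ^ d * 2 ^ ∑ i, s i := by
  rw [block, Fintype.card_piFinset]
  calc ∏ i, _ ≤ ∏ i, (2 * 2 ^ s i) := by
        refine Finset.prod_le_prod' fun i _ => (Finset.card_filter_le _ _).trans ?_
        rw [Int.card_Ioo]
        have : ((2 ^ s i : ℤ) - -2 ^ s i - 1) ≤ ((2 * 2 ^ s i : ℕ) : ℤ) := by push_cast; linarith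
        omega
    _ = _ := by rw [Finset.prod_mul_distrib, Finset.prod_const, Finset.prod_pow_eq_pow_sum]; simp

/-- The first coordinate is determined by the other `d - 1`, each of which is at most `j`. This
exponent is the source of the power of the logarithm. -/
theorem card_piAntidiag_le (d j : ℕ) :
    (Finset.piAntidiag (Finset.univ : Finset (Fin d)) j).card ≤ (j + 1) ^ (d - 1) := by
  rcases d with _ | d
  · simpa using Finset.card_le_univ (Finset.piAntidiag (Finset.univ : Finset (Fin 0)) j)
  have := Finset.card_le_card_of_injOn
    (s := Finset.piAntidiag (Finset.univ : Finset (Fin (d + 1))) j)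
    (t := Fintype.piFinset fun _ : Fin d => Finset.range (j + 1)) (fun s i => s i.succ) ?_ ?_
  · simpa using this
  · intro s hs
    have hs : ∑ i, s i = j := (Finset.mem_piAntidiag.1 hs).1
    rw [Finset.mem_coe, Fintype.mem_piFinset]
    intro i
    rw [Finset.mem_range]
    change s i.succ < j + 1
    have := Finset.single_le_sum (f := s) (fun _ _ => Nat.zero_le _) (Finset.mem_univ i.succ)
    omega
  · intro s hs t ht hst
    have hs : ∑ i, s i = j := (Finset.mem_piAntidiag.1 hs).1
    have ht : ∑ i, t i = j := (Finset.mem_piAntidiag.1 ht).1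
    rw [Fin.sum_univ_succ] at hs ht
    have h1 (i : Fin d) : s i.succ = t i.succ := congrFun hst i
    simp only [h1] at hs
    funext i
    refine Fin.cases ?_ h1 i
    omega

theorem card_layer_le (d j : ℕ) : (layer d j).card ≤ 2 ^ d * 2 ^ j * (j + 1) ^ (d - 1) := by
  calc (layer d j).card
      ≤ (Finset.piAntidiag (Finset.univ : Finset (Fin d)) j).card * (2 ^ d * 2 ^ j) := by
        refine Finset.card_biUnion_le_card_mul _ _ _ fun s hs => ?_
        refine (card_block_le s).trans_eq ?_
        rw [(Finset.mem_piAntidiag.1 hs).1]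
    _ ≤ (j + 1) ^ (d - 1) * (2 ^ d * 2 ^ j) := by gcongr; exact card_piAntidiag_le d j
    _ = _ := by ring

theorem sum_card_layer_le (d n : ℕ) :
    ∑ j ∈ Finset.range n, (layer d j).card ≤ 2 ^ d * 2 ^ n * n ^ (d - 1) := by
  calc ∑ j ∈ Finset.range n, (layer d j).card
      ≤ ∑ j ∈ Finset.range n, 2 ^ d * n ^ (d - 1) * 2 ^ j := by
        refine Finset.sum_le_sum fun j hj => (card_layer_le d j).trans ?_
        have : j + 1 ≤ n := Finset.mem_range.1 hj
        calc 2 ^ d * 2 ^ j * (j + 1) ^ (d - 1) ≤ 2 ^ d * 2 ^ j * n ^ (d - 1) := by gcongr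
          _ = _ := by ring
    _ = 2 ^ d * n ^ (d - 1) * ∑ j ∈ Finset.range n, 2 ^ j := by rw [Finset.mul_sum]
    _ ≤ 2 ^ d * n ^ (d - 1) * 2 ^ n := by
      gcongr
      rw [Nat.geomSum_eq le_rfl]
      simp
    _ = _ := by ring

/-- The layers partition the index set, and an unconditional sum in a complete space can be
regrouped along a partition. -/
theorem hasSum_layer {X : Type*} [NormedAddCommGroup X] [CompleteSpace X] {d : ℕ}
    {x : (Fin d → ℤ) → X} {f : X} (h : HasSum x f) :
    HasSum (fun j => ∑ k ∈ layer d j, x k) f := by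
  convert h.tsum_fiberwise (layerIndex (d := d)) using 2 with j
  have : layerIndex ⁻¹' {j} = (layer d j : Set (Fin d → ℤ)) := by
    ext k; simp [mem_layer]
  rw [this, Finset.tsum_subtype' (layer d j) x]

/-! ### Choice of the parameters -/

/-- Polynomial-versus-exponential comparison: `(n + i)^γ` is at most
`n^γ` up to a factor that is exponential in `i` with an arbitrarily small rate. -/
theorem exists_add_rpow_le (γ : ℝ) {ε : ℝ} (hε : 0 < ε) : ∃ C : ℝ, 1 ≤ C ∧
    ∀ n i : ℕ, 1 ≤ n → ((n + i : ℕ) : ℝ) ^ γ ≤ C * (n : ℝ) ^ γ * 2 ^ (ε * i) := by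
  have hl : 0 < Real.log 2 := Real.log_pos one_lt_two
  -- Small enough that `e^(δ i |γ|) ≤ 2^(ε i)`; the `+ 1` covers `γ = 0`.
  set δ := ε * Real.log 2 / (|γ| + 1) with hδ
  have hδ0 : 0 < δ := by positivity
  set M := max 1 δ⁻¹
  have hM : 1 ≤ M := le_max_left _ _
  refine ⟨M ^ |γ|, Real.one_le_rpow hM (abs_nonneg _), fun n i hn => ?_⟩
  have hn' : (1 : ℝ) ≤ n := by exact_mod_cast hn
  have hn0 : (0 : ℝ) < n := by linarith
  have hi : (0 : ℝ) ≤ i := Nat.cast_nonneg i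
  have h1 : (1 + i : ℝ) ≤ M * Real.exp (δ * i) := by
    have h2 : (1 + i : ℝ) ≤ M * (1 + δ * i) := by
      have : 1 ≤ M * δ := by
        calc (1 : ℝ) = δ⁻¹ * δ := (inv_mul_cancel₀ hδ0.ne').symm
          _ ≤ M * δ := by gcongr; exact le_max_right _ _
      nlinarith
    refine h2.trans ?_
    gcongr
    linarith [Real.add_one_le_exp (δ * i)]
  have h3 : (1 + i : ℝ) ^ |γ| ≤ M ^ |γ| * 2 ^ (ε * i) := by
    calc (1 + i : ℝ) ^ |γ| ≤ (M * Real.exp (δ * i)) ^ |γ| :=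
          Real.rpow_le_rpow (by positivity) h1 (abs_nonneg _)
      _ = M ^ |γ| * Real.exp (δ * i * |γ|) := by
          rw [Real.mul_rpow (by positivity) (by positivity), ← Real.exp_mul]
      _ ≤ M ^ |γ| * Real.exp (Real.log 2 * (ε * i)) := by
        have h2 : δ * |γ| ≤ ε * Real.log 2 := by
          rw [hδ, div_mul_eq_mul_div, div_le_iff₀ (by positivity)]
          have : 0 < ε * Real.log 2 := by positivity
          nlinarith
        have h3 : δ * i * |γ| ≤ Real.log 2 * (ε * i) := by
          nlinarith [mul_le_mul_of_nonneg_right h2 hi]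
        gcongr
      _ = _ := by rw [Real.rpow_def_of_pos two_pos]
  have h4 : (((n + i : ℕ) : ℝ) / n) ^ γ ≤ (1 + i : ℝ) ^ |γ| := by
    have hge : 1 ≤ ((n + i : ℕ) : ℝ) / n := by
      rw [one_le_div hn0]; push_cast; linarith
    calc (((n + i : ℕ) : ℝ) / n) ^ γ ≤ (((n + i : ℕ) : ℝ) / n) ^ |γ| :=
          Real.rpow_le_rpow_of_exponent_le hge (le_abs_self γ)
      _ ≤ (1 + i : ℝ) ^ |γ| := by
        refine Real.rpow_le_rpow (by positivity) ?_ (abs_nonneg _)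
        rw [div_le_iff₀ hn0]; push_cast; nlinarith
  calc ((n + i : ℕ) : ℝ) ^ γ = (((n + i : ℕ) : ℝ) / n) ^ γ * (n : ℝ) ^ γ := by
        rw [← Real.mul_rpow (by positivity) hn0.le, div_mul_cancel₀ _ hn0.ne']
    _ ≤ (M ^ |γ| * 2 ^ (ε * i)) * (n : ℝ) ^ γ := by gcongr; exact h4.trans h3
    _ = _ := by ring

/-- The level up to which the hyperbolic layers are kept completely. -/
theorem exists_level {d : ℕ} {v : ℕ} (hv : 4 * 2 ^ d ≤ v) : ∃ n : ℕ, 1 ≤ n ∧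
    2 * (2 ^ d * 2 ^ n * n ^ (d - 1)) ≤ v ∧ v ≤ 4 * 4 ^ d * (2 ^ n * n ^ (d - 1)) := by
  classical
  -- The least failing `n` gives a level that fits while the next does not. The hypothesis `4 * 2 ^
  -- d ≤ v` says that level `1` fits, which forces `n ≥ 1`.
  have hex : ∃ n : ℕ, ¬ 2 * (2 ^ d * 2 ^ (n + 1) * (n + 1) ^ (d - 1)) ≤ v := by
    refine ⟨v, ?_⟩
    have h1 : v < 2 ^ v := Nat.lt_two_pow_self
    have h2 : 1 ≤ 2 ^ d := Nat.one_le_two_pow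
    have h3 : 1 ≤ (v + 1) ^ (d - 1) := Nat.one_le_pow _ _ (by omega)
    have h4 : 1 * 2 ^ (v + 1) * 1 ≤ 2 ^ d * 2 ^ (v + 1) * (v + 1) ^ (d - 1) := by gcongr
    rw [pow_succ] at h4 ⊢
    omega
  set n := Nat.find hex with hn
  have hn1 : 1 ≤ n := by
    by_contra h
    have h0 : n = 0 := by omega
    have := Nat.find_spec hex
    rw [← hn, h0] at this
    apply this
    simp only [zero_add, pow_one, one_pow, mul_one]
    omega
  refine ⟨n, hn1, ?_, ?_⟩
  · have := Nat.find_min hex (m := n - 1) (by omega)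
    rw [not_not, Nat.sub_add_cancel hn1] at this
    exact this
  · have h1 := Nat.find_spec hex
    rw [← hn, not_le] at h1
    refine h1.le.trans ?_
    calc 2 * (2 ^ d * 2 ^ (n + 1) * (n + 1) ^ (d - 1))
        ≤ 2 * (2 ^ d * 2 ^ (n + 1) * (2 * n) ^ (d - 1)) := by gcongr; omega
      _ = 4 * 2 ^ d * 2 ^ (d - 1) * (2 ^ n * n ^ (d - 1)) := by rw [mul_pow]; ring
      _ ≤ 4 * 2 ^ d * 2 ^ d * (2 ^ n * n ^ (d - 1)) := by gcongr <;> omega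
      _ = _ := by rw [show 4 ^ d = 2 ^ d * 2 ^ d by rw [← mul_pow]; rfl]; ring

/-- The level is comparable to the logarithm of the number of terms. -/
theorem exists_level_rpow_le_log (d : ℕ) (y : ℝ) : ∃ C : ℝ, 0 < C ∧ ∀ v n : ℕ, 1 ≤ n →
    2 ^ n ≤ v → v ≤ 4 * 4 ^ d * (2 ^ n * n ^ (d - 1)) →
    (n : ℝ) ^ y ≤ C * Real.log (2 * v) ^ y := by
  have hl : 0 < Real.log 2 := Real.log_pos one_lt_two
  set M : ℝ := Real.log (2 * (4 * 4 ^ d)) + 1 + d with hM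
  have h1M : 0 ≤ Real.log (2 * (4 * 4 ^ d)) := by
    have h4 : (1 : ℝ) ≤ 4 ^ d := one_le_pow₀ (by norm_num)
    exact Real.log_nonneg (by linarith)
  have hM0 : 0 < M := by positivity
  -- The exponent `y` may have either sign, so `n` is compared with the logarithm from both sides;
  -- each summand serves one sign.
  refine ⟨(Real.log 2)⁻¹ ^ y + M⁻¹ ^ y, by positivity, fun v n hn h1 h2 => ?_⟩
  have hn' : (1 : ℝ) ≤ n := by exact_mod_cast hn
  have hn0 : (0 : ℝ) < n := by linarith
  have hv : (1 : ℝ) ≤ v := by exact_mod_cast (Nat.one_le_two_pow.trans h1)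
  have hlog : 0 < Real.log (2 * v) := Real.log_pos (by linarith)
  have hup : n ≤ (Real.log 2)⁻¹ * Real.log (2 * v) := by
    rw [← div_eq_inv_mul, le_div_iff₀ hl, ← Real.log_pow]
    refine Real.log_le_log (by positivity) ?_
    have : (2 : ℝ) ^ n ≤ v := by exact_mod_cast h1
    linarith
  have hlow : M⁻¹ * Real.log (2 * v) ≤ n := by
    rw [← div_eq_inv_mul, div_le_iff₀ hM0]
    have h3 : (2 * v : ℝ) ≤ 2 * (4 * 4 ^ d) * (2 ^ n * n ^ (d - 1)) := by
      have : (v : ℝ) ≤ 4 * 4 ^ d * (2 ^ n * n ^ (d - 1)) := by exact_mod_cast h2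
      linarith
    have h4 := Real.log_le_log (by positivity) h3
    rw [Real.log_mul (x := 2 * (4 * 4 ^ d)) (by positivity) (by positivity),
      Real.log_mul (x := 2 ^ n) (by positivity) (by positivity), Real.log_pow, Real.log_pow] at h4
    have h5 : Real.log n ≤ n := Real.log_le_self hn0.le
    have h6 : ((d - 1 : ℕ) : ℝ) * Real.log n ≤ d * n := by
      have : ((d - 1 : ℕ) : ℝ) ≤ d := by exact_mod_cast Nat.sub_le d 1
      have := Real.log_nonneg hn'
      gcongr
    have h7 : Real.log 2 ≤ 1 := by linarith [Real.log_two_lt_d9]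
    nlinarith
  rcases le_total 0 y with hy | hy
  · calc (n : ℝ) ^ y ≤ ((Real.log 2)⁻¹ * Real.log (2 * v)) ^ y := by gcongr
      _ = (Real.log 2)⁻¹ ^ y * Real.log (2 * v) ^ y := Real.mul_rpow (by positivity) hlog.le
      _ ≤ _ := by gcongr; linarith [Real.rpow_pos_of_pos (inv_pos.2 hM0) y]
  · calc (n : ℝ) ^ y ≤ (M⁻¹ * Real.log (2 * v)) ^ y :=
          Real.rpow_le_rpow_of_nonpos (by positivity) hlow hy
      _ = M⁻¹ ^ y * Real.log (2 * v) ^ y := Real.mul_rpow (by positivity) hlog.le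
      _ ≤ _ := by gcongr; linarith [Real.rpow_pos_of_pos (inv_pos.2 hl) y]

/-- The number of layers, above the level of `exists_level`, on which greedy steps are made. -/
theorem exists_depth {κ : ℝ} (hκ : 0 < κ) {V x : ℝ} (hx : x ≤ V) (hV : 1 ≤ V) : ∃ N : ℕ,
    (∀ i < N, 1 ≤ x * 2 ^ (-(κ * i))) ∧ (∀ i, N ≤ i → x * 2 ^ (-(κ * i)) ≤ 1) ∧
    (2 : ℝ) ^ N ≤ 2 * V ^ (1 / κ) := by
  classical
  have hlim : Filter.Tendsto (fun i : ℕ => V * ((2 : ℝ) ^ (-κ)) ^ i) Filter.atTop (nhds (V * 0)) :=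
    (tendsto_pow_atTop_nhds_zero_of_lt_one (by positivity)
      (Real.rpow_lt_one_of_one_lt_of_neg one_lt_two (by linarith))).const_mul V
  rw [mul_zero] at hlim
  have hpow (i : ℕ) : ((2 : ℝ) ^ (-κ)) ^ i = 2 ^ (-(κ * i)) := by
    rw [← Real.rpow_natCast, ← Real.rpow_mul two_pos.le, neg_mul]
  have hex : ∃ i : ℕ, x * 2 ^ (-(κ * i)) < 1 := by
    obtain ⟨i, hi⟩ := (hlim.eventually (gt_mem_nhds zero_lt_one)).exists
    refine ⟨i, lt_of_le_of_lt ?_ hi⟩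
    rw [hpow]; gcongr
  refine ⟨Nat.find hex, fun i hi => not_lt.1 (Nat.find_min hex hi), fun i hi => ?_, ?_⟩
  · rcases le_total x 0 with h | h
    · have : 0 < (2 : ℝ) ^ (-(κ * i)) := by positivity
      nlinarith
    refine le_trans ?_ (Nat.find_spec hex).le
    have : ((Nat.find hex : ℕ) : ℝ) ≤ i := by exact_mod_cast hi
    gcongr
    exact one_le_two
  · have hV1 : 1 ≤ V ^ (1 / κ) := Real.one_le_rpow hV (by positivity)
    -- Minimality at the predecessor bounds `2^N`; the factor `2` in the conclusion pays for the
    -- last step.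
    rcases h : Nat.find hex with _ | N
    · rw [pow_zero]; linarith
    have h1 : 1 ≤ V * 2 ^ (-(κ * N)) := by
      refine (not_lt.1 (Nat.find_min hex (m := N) (by omega))).trans ?_
      gcongr
    have h2 : (2 : ℝ) ^ (κ * N) ≤ V := by
      rw [Real.rpow_neg two_pos.le, ← div_eq_mul_inv, one_le_div (by positivity)] at h1
      exact h1
    have h3 : (2 : ℝ) ^ N ≤ V ^ (1 / κ) := by
      calc (2 : ℝ) ^ N = ((2 : ℝ) ^ (κ * N)) ^ (1 / κ) := by
            rw [← Real.rpow_mul two_pos.le, ← Real.rpow_natCast]; congr 1; field_simp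
        _ ≤ _ := by gcongr
    rw [pow_succ]; linarith

/-- The bound on the quasi-norm of the `j`-th layer of an admissible representation. -/
noncomputable def layerBound (a γ : ℝ) (j : ℕ) : ℝ := (2 : ℝ) ^ (-(a * j)) * (max (j : ℝ) 1) ^ γ

theorem layerBound_nonneg (a γ : ℝ) (j : ℕ) : 0 ≤ layerBound a γ j := by
  unfold layerBound; positivity

/-- A quarter of the exponential decay in `i` is spent on the growth of the polynomial factor
relative to level `n`; the rate `3a/4` remains. -/
theorem exists_layerBound_add_le (γ : ℝ) {a : ℝ} (ha : 0 < a) : ∃ C : ℝ, 1 ≤ C ∧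
    ∀ n i : ℕ, 1 ≤ n → layerBound a γ (n + i) ≤
      C * (n : ℝ) ^ γ * 2 ^ (-(a * n)) * 2 ^ (-(3 * a / 4 * i)) := by
  obtain ⟨C, hC, h⟩ := exists_add_rpow_le γ (ε := a / 4) (by linarith)
  refine ⟨C, hC, fun n i hn => ?_⟩
  have h1 : (1 : ℝ) ≤ (n + i : ℕ) := by exact_mod_cast (by omega : 1 ≤ n + i)
  rw [layerBound, max_eq_left h1]
  calc (2 : ℝ) ^ (-(a * (n + i : ℕ))) * ((n + i : ℕ) : ℝ) ^ γ
      ≤ 2 ^ (-(a * (n + i : ℕ))) * (C * (n : ℝ) ^ γ * 2 ^ (a / 4 * i)) := by gcongr; exact h n i hn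
    _ = C * (n : ℝ) ^ γ * (2 ^ (-(a * (n + i : ℕ))) * 2 ^ (a / 4 * i)) := by ring
    _ = C * (n : ℝ) ^ γ * (2 ^ (-(a * n)) * 2 ^ (-(3 * a / 4 * i))) := by
      rw [← Real.rpow_add two_pos, ← Real.rpow_add two_pos]
      congr 2; push_cast; ring
    _ = _ := by ring

theorem summable_layerBound (γ : ℝ) {a : ℝ} (ha : 0 < a) : Summable (layerBound a γ) := by
  obtain ⟨C, hC, h⟩ := exists_layerBound_add_le γ ha
  rw [← summable_nat_add_iff 1]
  have hr : Summable fun i : ℕ => ((2 : ℝ) ^ (-(3 * a / 4))) ^ i :=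
    summable_geometric_of_lt_one (by positivity)
      (Real.rpow_lt_one_of_one_lt_of_neg one_lt_two (by linarith))
  refine Summable.of_nonneg_of_le (fun i => layerBound_nonneg _ _ _) (fun i => ?_)
    (hr.mul_left (C * ((1 : ℕ) : ℝ) ^ γ * 2 ^ (-(a * (1 : ℕ)))))
  rw [add_comm i 1, ← Real.rpow_natCast, ← Real.rpow_mul two_pos.le, neg_mul]
  exact h 1 i le_rfl

/-- The parameters of the greedy method: all layers below level `n` are kept, on the layers
`n ≤ j < J` there are `θ j` largest coefficients and as many greedy steps.  The numbers `e j`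
bound the errors in the layers. -/
theorem exists_parameters {d : ℕ} (hd : 1 ≤ d) {a α : ℝ} (ha : 0 < a) (hα : 0 < α) :
    ∃ c : ℝ, 0 < c ∧ ∀ b : ℝ, ∃ C : ℝ, 0 < C ∧ ∀ v : ℕ, 4 * 2 ^ d ≤ v →
      ∃ (n J : ℕ) (θ : ℕ → ℕ) (e : ℕ → ℝ) (s : ℝ), n ≤ J ∧
        (∑ j ∈ Finset.range n, (layer d j).card) + ∑ j ∈ Finset.Ico n J, 2 * θ j ≤ v ∧
        ((∑ j ∈ Finset.range J, (layer d j).card : ℕ) : ℝ) ≤ (v : ℝ) ^ c ∧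
        (∀ j, n ≤ j → j < J → 1 ≤ θ j) ∧
        (∀ j < n, e j = 0) ∧
        (∀ j, n ≤ j → j < J →
          (θ j : ℝ) ^ (-α) * layerBound a (((d : ℝ) - 1) * b) j ≤ e j) ∧
        (∀ j, J ≤ j → layerBound a (((d : ℝ) - 1) * b) j ≤ e j) ∧
        HasSum e s ∧
        s ≤ C * (v : ℝ) ^ (-a - α) * Real.log (2 * v) ^ (((d : ℝ) - 1) * (a + b)) := by
  -- With `θ` of order `v 2^(-κi)`, the factor `θ^(-α)` costs `2^(ai/2)`; against the decay
  -- `2^(-3ai/4)` this leaves the ratio `ρ = 2^(-a/4)`.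
  set κ := a / (2 * α) with hκdef
  have hκ : 0 < κ := by positivity
  have hκα : κ * α = a / 2 := by rw [hκdef]; field_simp
  set r : ℝ := 2 ^ (-κ) with hrdef
  have hr0 : 0 < r := by positivity
  have hr1 : r < 1 := Real.rpow_lt_one_of_one_lt_of_neg one_lt_two (by linarith)
  -- Makes the geometric sum of the counts `2 θ` at most `v/2`; the fully kept layers use the other
  -- half.
  set σ := (1 - r) / 4 with hσ
  have hσ0 : 0 < σ := by rw [hσ]; linarith
  have hd0 : (0 : ℝ) < d := by exact_mod_cast hd
  -- Depth costs `2^N ≤ 2 v^(1/κ)` and the level `4 * 2^n ≤ v`, while the number of indices is at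
  -- most `(2 * 2^(n+N))^d`. Nothing here involves `b`.
  refine ⟨(1 + 1 / κ) * d, by positivity, fun b => ?_⟩
  set γ := ((d : ℝ) - 1) * b with hγ
  obtain ⟨Cb, hCb, hR⟩ := exists_layerBound_add_le γ ha
  obtain ⟨Cl, hCl, hlog⟩ := exists_level_rpow_le_log d (((d : ℝ) - 1) * (a + b))
  set ρ : ℝ := 2 ^ (-(a / 4)) with hρ
  have hρ0 : 0 < ρ := by positivity
  have hρ1 : ρ < 1 := Real.rpow_lt_one_of_one_lt_of_neg one_lt_two (by linarith)
  have hρ' : 0 < (1 - ρ)⁻¹ := inv_pos.2 (by linarith)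
  set C₁ : ℝ := 4 * 4 ^ d with hC₁
  refine ⟨(σ / 2) ^ (-α) * Cb * C₁ ^ a * Cl * (1 - ρ)⁻¹, by positivity, fun v hv => ?_⟩
  obtain ⟨n, hn, hnv, hvn⟩ := exists_level hv
  have hn0 : (0 : ℝ) < n := by exact_mod_cast hn
  have hv1 : 1 ≤ v := le_trans (by have := Nat.one_le_two_pow (n := d); omega) hv
  have hv1' : (1 : ℝ) ≤ v := by exact_mod_cast hv1
  have hv0 : (0 : ℝ) < v := by linarith
  have hn2 : 4 * 2 ^ n ≤ v := by
    refine le_trans ?_ hnv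
    have h1 : 2 ^ 1 ≤ 2 ^ d := Nat.pow_le_pow_right two_pos hd
    have h2 : 1 ≤ n ^ (d - 1) := Nat.one_le_pow _ _ hn
    calc 4 * 2 ^ n = 2 * (2 ^ 1 * 2 ^ n * 1) := by ring
      _ ≤ _ := by gcongr
  obtain ⟨N, hN1, hN2, hN3⟩ := exists_depth hκ (x := σ * v) (V := v)
    (by have : σ ≤ 1 := by rw [hσ]; linarith
        nlinarith) hv1'
  set x : ℕ → ℝ := fun i => σ * v * 2 ^ (-(κ * i)) with hx
  have hx0 (i : ℕ) : 0 < x i := by positivity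
  set A : ℝ := (σ / 2) ^ (-α) * (v : ℝ) ^ (-α) * (Cb * (n : ℝ) ^ γ * 2 ^ (-(a * n))) with hA
  have hA0 : 0 ≤ A := by positivity
  -- One bound serves both ranges: below the depth the floor of `x i` is at least `x i / 2`, and
  -- beyond it `x i / 2 ≤ 1` makes the first factor at least `1`.
  have hmain (i : ℕ) : (x i / 2) ^ (-α) * layerBound a γ (n + i) ≤ A * ρ ^ i := by
    have e1 : (x i / 2) ^ (-α) = (σ / 2) ^ (-α) * (v : ℝ) ^ (-α) * 2 ^ (a / 2 * i) := by
      rw [hx, show σ * v * 2 ^ (-(κ * i)) / 2 = σ / 2 * v * (2 : ℝ) ^ (-(κ * i)) by ring,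
        Real.mul_rpow (by positivity) (by positivity), Real.mul_rpow (by positivity) hv0.le,
        ← Real.rpow_mul two_pos.le, ← hκα]
      congr 2; ring
    have e2 : ρ ^ i = 2 ^ (a / 2 * i) * 2 ^ (-(3 * a / 4 * i)) := by
      rw [hρ, ← Real.rpow_natCast, ← Real.rpow_mul two_pos.le, ← Real.rpow_add two_pos]
      congr 1; ring
    calc (x i / 2) ^ (-α) * layerBound a γ (n + i)
        ≤ (x i / 2) ^ (-α) * (Cb * (n : ℝ) ^ γ * 2 ^ (-(a * n)) * 2 ^ (-(3 * a / 4 * i))) := by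
          gcongr; exact hR n i hn
      _ = A * ρ ^ i := by rw [e1, e2, hA]; ring
  set e : ℕ → ℝ := fun j => if j < n then 0 else A * ρ ^ (j - n) with he
  have hes : HasSum e (A * (1 - ρ)⁻¹) := by
    have h1 : HasSum (fun i => e (i + n)) (A * (1 - ρ)⁻¹) := by
      simpa [he] using (hasSum_geometric_of_lt_one hρ0.le hρ1).mul_left A
    have h2 := (hasSum_nat_add_iff n).1 h1
    rwa [Finset.sum_eq_zero, add_zero] at h2
    intro j hj
    simp [he, Finset.mem_range.1 hj]
  refine ⟨n, n + N, fun j => ⌊x (j - n)⌋₊, e, _, Nat.le_add_right _ _, ?_, ?_, ?_,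
    fun j hj => by simp [he, hj], ?_, ?_, hes, ?_⟩
  · have h1 : 2 * ∑ j ∈ Finset.range n, (layer d j).card ≤ v :=
      (Nat.mul_le_mul_left 2 (sum_card_layer_le d n)).trans hnv
    have h2 : 2 * ∑ j ∈ Finset.Ico n (n + N), 2 * ⌊x (j - n)⌋₊ ≤ v := by
      rw [Finset.sum_Ico_eq_sum_range]
      simp only [Nat.add_sub_cancel_left]
      have h3 : ∑ i ∈ Finset.range N, r ^ i ≤ (1 - r)⁻¹ := by
        rw [← tsum_geometric_of_lt_one hr0.le hr1]
        exact (summable_geometric_of_lt_one hr0.le hr1).sum_le_tsum _ fun i _ => by positivity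
      have h4 : (2 * ∑ i ∈ Finset.range N, 2 * (⌊x i⌋₊ : ℝ)) ≤ v := by
        calc (2 * ∑ i ∈ Finset.range N, 2 * (⌊x i⌋₊ : ℝ))
            ≤ 2 * ∑ i ∈ Finset.range N, 2 * (σ * v) * r ^ i := by
              refine mul_le_mul_of_nonneg_left (Finset.sum_le_sum fun i _ => ?_) two_pos.le
              refine (mul_le_mul_of_nonneg_left (Nat.floor_le (hx0 i).le) two_pos.le).trans_eq ?_
              rw [hx, hrdef, ← Real.rpow_natCast, ← Real.rpow_mul two_pos.le, neg_mul]
              ring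
          _ = 4 * (σ * v) * ∑ i ∈ Finset.range N, r ^ i := by rw [← Finset.mul_sum]; ring
          _ ≤ 4 * (σ * v) * (1 - r)⁻¹ := by gcongr
          _ = v := by
            have : 1 - r ≠ 0 := by linarith
            rw [hσ]; field_simp
      exact_mod_cast h4
    dsimp only
    omega
  · have h1 : ∑ j ∈ Finset.range (n + N), (layer d j).card ≤ (2 * 2 ^ (n + N)) ^ d := by
      refine (sum_card_layer_le d (n + N)).trans ?_
      calc 2 ^ d * 2 ^ (n + N) * (n + N) ^ (d - 1)
          ≤ 2 ^ d * 2 ^ (n + N) * (2 ^ (n + N)) ^ (d - 1) := by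
            gcongr; exact Nat.lt_two_pow_self.le
        _ = 2 ^ d * ((2 ^ (n + N)) ^ (d - 1) * 2 ^ (n + N)) := by ring
        _ = (2 * 2 ^ (n + N)) ^ d := by
          rw [← pow_succ, Nat.sub_add_cancel hd, mul_pow]
    have h2 : (2 * 2 ^ (n + N) : ℝ) ≤ (v : ℝ) ^ (1 + 1 / κ) := by
      rw [Real.rpow_add hv0, Real.rpow_one, pow_add]
      have h3 : (4 * 2 ^ n : ℝ) ≤ v := by exact_mod_cast hn2
      calc (2 * (2 ^ n * 2 ^ N) : ℝ) ≤ 2 * (2 ^ n * (2 * (v : ℝ) ^ (1 / κ))) := by gcongr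
        _ = 4 * 2 ^ n * (v : ℝ) ^ (1 / κ) := by ring
        _ ≤ _ := by gcongr
    calc ((∑ j ∈ Finset.range (n + N), (layer d j).card : ℕ) : ℝ)
        ≤ (2 * 2 ^ (n + N)) ^ d := by exact_mod_cast h1
      _ ≤ ((v : ℝ) ^ (1 + 1 / κ)) ^ d := by gcongr
      _ = _ := by rw [← Real.rpow_natCast, ← Real.rpow_mul hv0.le]
  · intro j hj hjN
    exact Nat.le_floor (by simpa using hN1 (j - n) (by omega))
  · intro j hj hjN
    obtain ⟨i, rfl⟩ := Nat.exists_eq_add_of_le hj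
    have hi : i < N := by omega
    simp only [Nat.add_sub_cancel_left, he, not_lt.2 hj, if_false]
    refine le_trans ?_ (hmain i)
    refine mul_le_mul_of_nonneg_right ?_ (layerBound_nonneg _ _ _)
    refine Real.rpow_le_rpow_of_nonpos (by have := hx0 i; positivity) ?_ (by linarith)
    have h1 : (1 : ℝ) ≤ ⌊x i⌋₊ := by
      exact_mod_cast Nat.le_floor (by simpa using hN1 i hi)
    linarith [Nat.lt_floor_add_one (x i)]
  · intro j hj
    obtain ⟨i, rfl⟩ := Nat.exists_eq_add_of_le (le_trans (Nat.le_add_right n N) hj)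
    have hi : N ≤ i := by omega
    simp only [Nat.add_sub_cancel_left, he, not_lt.2 (Nat.le_add_right n i), if_false]
    refine le_trans ?_ (hmain i)
    refine le_mul_of_one_le_left (layerBound_nonneg _ _ _) ?_
    have := hN2 i hi
    have h2 := hx0 i
    exact Real.one_le_rpow_of_pos_of_le_one_of_nonpos (by positivity)
      (by change x i ≤ 1 at this; linarith) (by linarith)
  -- Maximality of the level, `v ≤ C₁ 2^n n^(d-1)`, trades `2^(-an)` for `v^(-a)` at the price of
  -- `n^((d-1)a)`.
  · have h1 : (2 : ℝ) ^ (-(a * n)) ≤ C₁ ^ a * (v : ℝ) ^ (-a) * (n : ℝ) ^ (((d : ℝ) - 1) * a) := by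
      have h2 : (v : ℝ) ≤ C₁ * (2 ^ n * (n : ℝ) ^ (d - 1)) := by
        rw [hC₁]; exact_mod_cast hvn
      have h3 : (v : ℝ) ^ a ≤ C₁ ^ a * (2 ^ (a * n) * (n : ℝ) ^ (((d : ℝ) - 1) * a)) := by
        calc (v : ℝ) ^ a ≤ (C₁ * (2 ^ n * (n : ℝ) ^ (d - 1))) ^ a := by gcongr
          _ = _ := by
            rw [Real.mul_rpow (x := C₁) (by positivity) (by positivity),
              Real.mul_rpow (x := 2 ^ n) (by positivity) (by positivity), ← Real.rpow_natCast 2 n,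
              ← Real.rpow_mul two_pos.le, ← Real.rpow_natCast (n : ℝ), ← Real.rpow_mul hn0.le,
              Nat.cast_sub hd, Nat.cast_one, mul_comm a (n : ℝ)]
      rw [Real.rpow_neg two_pos.le, Real.rpow_neg hv0.le,
        inv_le_iff_one_le_mul₀ (by positivity)]
      calc (1 : ℝ) = (v : ℝ) ^ a * ((v : ℝ) ^ a)⁻¹ := (mul_inv_cancel₀ (by positivity)).symm
        _ ≤ (C₁ ^ a * (2 ^ (a * n) * (n : ℝ) ^ (((d : ℝ) - 1) * a))) * ((v : ℝ) ^ a)⁻¹ := by gcongr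
        _ = _ := by ring
    have h2 := hlog v n hn (le_trans (by omega) hn2) hvn
    calc A * (1 - ρ)⁻¹
        ≤ (σ / 2) ^ (-α) * (v : ℝ) ^ (-α) * (Cb * (n : ℝ) ^ γ *
          (C₁ ^ a * (v : ℝ) ^ (-a) * (n : ℝ) ^ (((d : ℝ) - 1) * a))) * (1 - ρ)⁻¹ := by
          rw [hA]; gcongr
      _ = (σ / 2) ^ (-α) * Cb * C₁ ^ a * (1 - ρ)⁻¹ * ((v : ℝ) ^ (-a) * (v : ℝ) ^ (-α)) *
          ((n : ℝ) ^ (((d : ℝ) - 1) * a) * (n : ℝ) ^ γ) := by ring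
      _ = (σ / 2) ^ (-α) * Cb * C₁ ^ a * (1 - ρ)⁻¹ * (v : ℝ) ^ (-a - α) *
          (n : ℝ) ^ (((d : ℝ) - 1) * (a + b)) := by
        rw [← Real.rpow_add hv0, ← Real.rpow_add hn0, hγ, ← sub_eq_add_neg, ← mul_add]
      _ ≤ (σ / 2) ^ (-α) * Cb * C₁ ^ a * (1 - ρ)⁻¹ * (v : ℝ) ^ (-a - α) *
          (Cl * Real.log (2 * v) ^ (((d : ℝ) - 1) * (a + b))) := by gcongr
      _ = _ := by ring

/-! ### Errors in a layer and in a whole run -/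

theorem IsLargest.eq_of_card_le {ι : Type*} {coef : ι → ℂ} {D I : Finset ι} {m : ℕ}
    (h : IsLargest coef D m I) (hm : D.card ≤ m) : I = D :=
  Finset.eq_of_subset_of_card_le h.1 (by rw [h.2.1, min_eq_right hm])

theorem IsWCGAResult.eq_zero {X : Type*} [NormedAddCommGroup X] [NormedSpace ℂ X] {ι : Type*}
    {t : ℝ} {ψ : ι → X} {D : Finset ι} {r g : X} (h : IsWCGAResult t ψ D r 0 g) : g = 0 := by
  obtain ⟨φ, G, hG0, -, rfl⟩ := h
  exact hG0

theorem IsLargest.isTermApproximant_add {X : Type*} [NormedAddCommGroup X] [NormedSpace ℂ X]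
    {ι : Type*} {t : ℝ} {ψ : ι → X} {coef : ι → ℂ} {D I : Finset ι} {r h : X} {m w : ℕ}
    (hI : IsLargest coef D m I) (hh : IsWCGAResult t ψ D r w h) :
    IsTermApproximant (m + w) ψ D ((∑ k ∈ I, coef k • ψ k) + h) :=
  IsTermApproximant.add ⟨I, hI.1, hI.2.1.trans_le (min_le_left _ _), coef, rfl⟩
    hh.isTermApproximant

/-- The error of the greedy method in a layer where `θ` coefficients are kept and `θ` greedy
iterations are made. -/
theorem HasPowerSmoothness.exists_layer_error {K q β : ℝ} (hK : 1 ≤ K) (hq : 1 < q)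
    (hβ : 0 < β) (hβ' : β ≤ 1) :
    ∃ C : ℝ, 0 < C ∧ ∀ (X : Type*) [NormedAddCommGroup X] [NormedSpace ℂ X]
      (ι : Type*) [DecidableEq ι],
      HasPowerSmoothness X K q → ∀ (ψ : ι → X) (D I : Finset ι), (∀ k, ‖ψ k‖ ≤ 1) →
      ∀ (coef : ι → ℂ) (R : ℝ) (θ : ℕ) (h : X), 1 ≤ θ →
        (∑ k ∈ D, ‖coef k‖ ^ β) ^ (1 / β) ≤ R → IsLargest coef D θ I →
        IsWCGAResult 1 ψ D (∑ k ∈ D \ I, coef k • ψ k) θ h →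
        ‖(∑ k ∈ D, coef k • ψ k) - ((∑ k ∈ I, coef k • ψ k) + h)‖ ≤
          C * ((θ : ℝ) ^ (-(1 / β - 1 / q)) * R) := by
  obtain ⟨C, hC, hrate⟩ := HasPowerSmoothness.exists_wcga_rate hK hq
  refine ⟨C, hC, fun X _ _ ι _ hX ψ D I hψ coef R θ h hθ hR hI hh => ?_⟩
  have hθ0 : (0 : ℝ) < θ := by exact_mod_cast hθ
  have hR0 := nonneg_of_quasinorm_le hR
  have hq1 : 1 / q - 1 ≤ 0 := by
    rw [sub_nonpos, div_le_one (by linarith)]; exact hq.le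
  -- The kept terms are reproduced exactly, so only the error of the WCGA on the tail remains.
  rw [← Finset.sum_sdiff hI.1, add_comm, add_sub_add_left_eq_sub]
  calc ‖(∑ k ∈ D \ I, coef k • ψ k) - h‖
      ≤ C * (∑ k ∈ D \ I, ‖coef k‖) * (1 + θ : ℝ) ^ (1 / q - 1) :=
        hrate X ι hX ψ D (D \ I) Finset.sdiff_subset hψ coef θ h hh
    _ ≤ C * ((θ : ℝ) ^ (1 - 1 / β) * R) * (θ : ℝ) ^ (1 / q - 1) := by
        refine mul_le_mul ?_ (Real.rpow_le_rpow_of_nonpos hθ0 (by linarith) hq1)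
          (by positivity) (by positivity)
        gcongr
        exact hI.sum_sdiff_le hβ hβ' hR hθ
    _ = C * (((θ : ℝ) ^ (1 - 1 / β) * (θ : ℝ) ^ (1 / q - 1)) * R) := by ring
    _ = _ := by rw [← Real.rpow_add hθ0]; congr 3; ring

section Run

variable {X : Type*} [NormedAddCommGroup X] [NormedSpace ℂ X] {d : ℕ}

theorem GreedyMethod.exists_returns (hd : 1 ≤ d) (M : GreedyMethod) (ψ : (Fin d → ℤ) → X)
    (coef : (Fin d → ℤ) → ℂ) : ∃ g, M.Returns ψ coef g := by
  choose I hI using fun j => exists_isLargest coef (layer d j) (M.keep j)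
  choose h hh using fun j => exists_isWCGAResult M.t_le_one ψ (layer_nonempty hd j)
    (∑ k ∈ layer d j \ I j, coef k • ψ k) (M.steps j)
  exact ⟨_, I, h, fun j _ => ⟨hI j, hh j⟩, rfl⟩

theorem GreedyMethod.Returns.isTermApproximant {M : GreedyMethod} {ψ : (Fin d → ℤ) → X}
    {coef : (Fin d → ℤ) → ℂ} {g : X} (h : M.Returns ψ coef g) :
    IsTermApproximant (∑ j ∈ Finset.range M.J, (M.keep j + M.steps j)) ψ
      ((Finset.range M.J).biUnion (layer d)) g := by
  obtain ⟨I, h, hIh, rfl⟩ := h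
  refine isTermApproximant_sum _ fun j hj => ?_
  obtain ⟨hI, hh⟩ := hIh j (Finset.mem_range.1 hj)
  exact (hI.isTermApproximant_add hh).mono le_rfl (Finset.subset_biUnion_of_mem _ hj)

variable {a b β : ℝ} {ψ : (Fin d → ℤ) → X} {f : X} {coef : (Fin d → ℤ) → ℂ}

/-- Controls the layers that the method discards, through `ℓ_β ⊂ ℓ_1` and the normalisation of the
system. -/
theorem IsAdmissibleRep.norm_layer_le (h : IsAdmissibleRep a b β ψ f coef) (hβ : 0 < β)
    (hβ' : β ≤ 1) (hψ : ∀ k, ‖ψ k‖ ≤ 1) (j : ℕ) :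
    ‖∑ k ∈ layer d j, coef k • ψ k‖ ≤ layerBound a (((d : ℝ) - 1) * b) j := by
  refine le_trans (norm_sum_le_of_le _ fun k _ => ?_)
    (sum_norm_le_of_quasinorm_le hβ hβ' (h.2.2 j))
  rw [norm_smul]
  exact mul_le_of_le_one_right (norm_nonneg _) (hψ k)

/-- The error of a run is bounded by the sum of the errors in the layers. -/
theorem GreedyMethod.Returns.norm_sub_le [CompleteSpace X] {M : GreedyMethod} {g : X}
    (hf : HasSum (fun k => coef k • ψ k) f) (hg : M.Returns ψ coef g) {e : ℕ → ℝ} {s : ℝ}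
    (he : HasSum e s)
    (hlow : ∀ j < M.J, ∀ I h, IsLargest coef (layer d j) (M.keep j) I →
      IsWCGAResult M.t ψ (layer d j) (∑ k ∈ layer d j \ I, coef k • ψ k) (M.steps j) h →
      ‖(∑ k ∈ layer d j, coef k • ψ k) - ((∑ k ∈ I, coef k • ψ k) + h)‖ ≤ e j)
    (hhigh : ∀ j, M.J ≤ j → ‖∑ k ∈ layer d j, coef k • ψ k‖ ≤ e j) :
    ‖f - g‖ ≤ s := by
  obtain ⟨I, h, hIh, rfl⟩ := hg
  -- Padding the output by zeros turns `f - g` into one series of layer errors, compared termwise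
  -- with `e`.
  set y : ℕ → X := fun j => if j < M.J then (∑ k ∈ I j, coef k • ψ k) + h j else 0 with hy
  have hsum : HasSum y (∑ j ∈ Finset.range M.J, ((∑ k ∈ I j, coef k • ψ k) + h j)) := by
    have h1 : ∑ j ∈ Finset.range M.J, ((∑ k ∈ I j, coef k • ψ k) + h j) =
        ∑ j ∈ Finset.range M.J, y j :=
      Finset.sum_congr rfl fun j hj => by simp [hy, Finset.mem_range.1 hj]
    rw [h1]
    exact hasSum_sum_of_ne_finset_zero fun j hj => by
      rw [Finset.mem_range] at hj; simp [hy, hj]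
  refine ((hasSum_layer hf).sub hsum).norm_le_of_bounded he fun j => ?_
  rcases lt_or_ge j M.J with hj | hj
  · simp only [hy, hj, if_true]
    exact hlow j hj _ _ (hIh j hj).1 (hIh j hj).2
  · simp only [hy, not_lt.2 hj, if_false, sub_zero]
    exact hhigh j hj

end Run

end MixedGreedy

/-! ### Assembly of the theorem -/

open MixedGreedy in
theorem theorem5p1 (d : ℕ) (hd : 1 ≤ d) (p : ℝ≥0∞) [Fact (1 ≤ p)] (hp : 1 < p) (hp' : p ≠ ∞)
    (a : ℝ) (ha : 0 < a) (β : ℝ) (hβ : 0 < β) (hβ' : β ≤ 1) :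
    ∃ c : ℝ, 0 < c ∧ ∀ b : ℝ, ∃ C : ℝ, 0 < C ∧
      ∀ v : ℕ, 1 ≤ v →
        ∃ (Q : Finset (Fin d → ℤ)) (M : MixedGreedy.GreedyMethod),
          (Q.card : ℝ) ≤ (v : ℝ) ^ c ∧
          ∀ (Ω : Type*) [MeasurableSpace Ω] (μ : Measure Ω) [IsProbabilityMeasure μ]
            (ψ : (Fin d → ℤ) → Lp ℂ p μ), (∀ k, ‖ψ k‖ ≤ 1) →
            ∀ f ∈ MixedGreedy.mixedClass a b β ψ,
              ∀ coef, MixedGreedy.IsAdmissibleRep a b β ψ f coef →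
                (∃ g, M.Returns ψ coef g) ∧
                ∀ g, M.Returns ψ coef g →
                  MixedGreedy.IsTermApproximant v ψ Q g ∧
                  ‖f - g‖ ≤ C * (v : ℝ) ^ (-a + 1 / min p.toReal 2 - 1 / β) *
                    (Real.log (2 * v)) ^ (((d : ℝ) - 1) * (a + b)) := by
  have hP : 1 < p.toReal := by
    rw [← ENNReal.toReal_one]; exact (ENNReal.toReal_lt_toReal (by simp) hp').2 hp
  obtain ⟨K, hK, hsmooth⟩ := exists_hasPowerSmoothness_Lp hp hp'
  set q := min p.toReal 2 with hqdef
  have hq : 1 < q := lt_min hP one_lt_two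
  obtain ⟨Cw, hCw, hlayer⟩ := HasPowerSmoothness.exists_layer_error hK hq hβ hβ'
  have hα : 0 < 1 / β - 1 / q := by
    have h1 : 1 / q < 1 := (div_lt_one (by linarith)).2 hq
    have h2 : 1 ≤ 1 / β := (one_le_div hβ).2 hβ'
    linarith
  obtain ⟨c, hc, hparam⟩ := exists_parameters hd ha hα
  refine ⟨c, hc, fun b => ?_⟩
  obtain ⟨C₂, hC₂, hparam⟩ := hparam b
  set γ := ((d : ℝ) - 1) * b with hγ
  have hS := summable_layerBound γ ha
  set S := ∑' j, layerBound a γ j with hSdef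
  have hS0 : 0 ≤ S := tsum_nonneg fun j => layerBound_nonneg _ _ _
  set rate : ℕ → ℝ := fun v => (v : ℝ) ^ (-a + 1 / q - 1 / β) *
    (Real.log (2 * v)) ^ (((d : ℝ) - 1) * (a + b)) with hrate
  have hrate0 (v : ℕ) (hv : 1 ≤ v) : 0 < rate v := by
    have hv1 : (1 : ℝ) ≤ v := by exact_mod_cast hv
    have := Real.log_pos (by linarith : (1 : ℝ) < 2 * v)
    have : (0 : ℝ) < v := by linarith
    positivity
  have hT0 (v : ℕ) (hv : v ∈ Finset.Ico 1 (4 * 2 ^ d)) : 0 ≤ (rate v)⁻¹ :=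
    (inv_pos.2 (hrate0 v (Finset.mem_Ico.1 hv).1)).le
  -- The finitely many `v` below the threshold are handled by the constant: `T` dominates each
  -- `(rate v)⁻¹`.
  set T := ∑ v ∈ Finset.Ico 1 (4 * 2 ^ d), (rate v)⁻¹ with hT
  have hTnn : 0 ≤ T := Finset.sum_nonneg hT0
  have hCm : 1 ≤ max Cw 1 := le_max_right _ _
  have hCm0 : 0 < max Cw 1 := zero_lt_one.trans_le hCm
  -- The maximum with `1` is needed because the discarded layers are bounded by `e j` itself, not by
  -- `Cw * e j`.
  refine ⟨max Cw 1 * C₂ + S * T, by positivity, fun v hv => ?_⟩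
  rcases lt_or_ge v (4 * 2 ^ d) with hvs | hvs
  -- With `J = 0` the method returns `0`, and `S` bounds the norm of `f`.
  · refine ⟨∅, ⟨1, one_pos, le_rfl, 0, 0, 0⟩, by simp; positivity, ?_⟩
    intro Ω _ μ _ ψ hψ f _ coef hadm
    refine ⟨GreedyMethod.exists_returns hd _ ψ coef, fun g hg => ⟨?_, ?_⟩⟩
    · simpa using hg.isTermApproximant.mono (Nat.zero_le v) subset_rfl
    · have h1 := hg.norm_sub_le hadm.2.1 hS.hasSum (fun j hj => absurd hj (Nat.not_lt_zero j))
        (fun j _ => hadm.norm_layer_le hβ hβ' hψ j)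
      rw [mul_assoc]
      change _ ≤ _ * rate v
      have h2 : (rate v)⁻¹ ≤ T :=
        Finset.single_le_sum hT0 (Finset.mem_Ico.2 ⟨hv, hvs⟩)
      calc ‖f - g‖ ≤ S := h1
        _ = S * (rate v)⁻¹ * rate v := by
          rw [mul_assoc, inv_mul_cancel₀ (hrate0 v hv).ne', mul_one]
        _ ≤ (max Cw 1 * C₂ + S * T) * rate v := by
          have := mul_le_mul_of_nonneg_left h2 hS0
          have : 0 ≤ max Cw 1 * C₂ := by positivity
          exact mul_le_mul_of_nonneg_right (by linarith) (hrate0 v hv).le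
  · obtain ⟨n, J, θ, e, s, hnJ, hcount, hQ, hθ, he0, heθ, heJ, hes, hs⟩ := hparam v hvs
    -- Below `n` every coefficient is kept and no iteration is made, so these layers are exact;
    -- above, kept terms and iterations each use `θ j` of the budget.
    refine ⟨(Finset.range J).biUnion (layer d), ⟨1, one_pos, le_rfl, J,
      fun j => if j < n then (layer d j).card else θ j, fun j => if j < n then 0 else θ j⟩,
      le_trans (by exact_mod_cast Finset.card_biUnion_le) hQ, ?_⟩
    intro Ω _ μ _ ψ hψ f _ coef hadm
    refine ⟨GreedyMethod.exists_returns hd _ ψ coef, fun g hg => ⟨?_, ?_⟩⟩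
    · refine hg.isTermApproximant.mono (le_trans (le_of_eq ?_) hcount) subset_rfl
      rw [← Finset.sum_range_add_sum_Ico _ hnJ]
      refine congrArg₂ _ (Finset.sum_congr rfl fun j hj => ?_) (Finset.sum_congr rfl fun j hj => ?_)
      · simp [Finset.mem_range.1 hj]
      · simp [not_lt.2 (Finset.mem_Ico.1 hj).1, two_mul]
    · have h1 : ‖f - g‖ ≤ max Cw 1 * s := by
        refine hg.norm_sub_le hadm.2.1 (hes.mul_left _) ?_ ?_
        · intro j hj I h hI hh
          rcases lt_or_ge j n with hjn | hjn
          · simp only [hjn, if_true] at hI hh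
            rw [hI.eq_of_card_le le_rfl, hh.eq_zero, he0 j hjn]
            simp
          · simp only [not_lt.2 hjn, if_false] at hI hh
            refine (hlayer _ _ (hsmooth Ω μ) ψ _ _ hψ coef _ _ h (hθ j hjn hj)
              (hadm.2.2 j) hI (by convert hh)).trans ?_
            have h2 := heθ j hjn hj
            have h3 : 0 ≤ (θ j : ℝ) ^ (-(1 / β - 1 / q)) * layerBound a γ j :=
              mul_nonneg (by positivity) (layerBound_nonneg _ _ _)
            exact mul_le_mul (le_max_left _ _) h2 h3 hCm0.le
        · intro j hj
          have h2 := heJ j hj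
          have h3 := layerBound_nonneg a γ j
          refine (hadm.norm_layer_le hβ hβ' hψ j).trans ?_
          exact h2.trans (le_mul_of_one_le_left (h3.trans h2) hCm)
      have h2 : s ≤ C₂ * rate v := by
        rw [hrate, ← mul_assoc, show -a + 1 / q - 1 / β = -a - (1 / β - 1 / q) by ring]
        exact hs
      rw [mul_assoc]
      change _ ≤ _ * rate v
      calc ‖f - g‖ ≤ max Cw 1 * (C₂ * rate v) := h1.trans (by gcongr)
        _ = max Cw 1 * C₂ * rate v := by ring
        _ ≤ _ := mul_le_mul_of_nonneg_right
          (le_add_of_nonneg_right (mul_nonneg hS0 hTnn)) (hrate0 v hv).le
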